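/- Let $d\in\mathbb N$, $T>0$, $\mathbf m,x_T\in\mathbb R^d$, and let $f,h,g:[0,T]\to\mathbb R$ be continuous, with $g$ not identically zero on any nondegenerate subinterval of $[0,T]$. For $0\le s<t\le T$ put $\bar f_{s:t}=\int_s^t f_z\,dz$, $\bar f_t=\bar f_{0:t}$, $\bar h_{s:t}=\int_s^t e^{-\bar f_z}h_z\,dz$, $\bar g^2_{s:t}=\int_s^t e^{-2\bar f_z}g_z^2\,dz$, and let $p(x_t\mid x_s)$ be the density at $x_t$ of $\mathcal N\big(e^{\bar f_{s:t}}x_s+e^{\bar f_t}\bar h_{s:t}\mathbf m,\; e^{2\bar f_t}\bar g^2_{s:t} I\big)$. For $\gamma>0$ and initial data $(s,x)\in[0,T)\times\mathbb R^d$ consider the control problem $$\min_{u\in L^2([s,T];\mathbb R^d)}\ \int_s^T\tfrac12\|u_t\|^2dt+\tfrac\gamma2\|\mathbf x_T-x_T\|^2,\qquad d\mathbf x_t=(f_t\mathbf x_t+h_t\mathbf m+g_tu_t)\,dt,\quad \mathbf x_s=x .$$ An optimal feedback controller is a continuous $U_\gamma:[0,T]\times\mathbb R^d\to\mathbb R^d$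 such that, for every such $(s,x)$, there is a closed-loop trajectory started at $(s,x)$ along which the control $u_t=U_\gamma(t,\mathbf x_t)$ is optimal. Weak solutions of SDEs are continuous adapted solutions of the martingale problem. Then the following hold. 1. $p$ is the transition density of the uncontrolled SDE $d\mathbf x_t=(f_t\mathbf x_t+h_t\mathbf m)\,dt+g_t\,d\mathbf w_t$: for every weak solution on $[0,T]$ with filtration $(\mathcal F_t)$ and all $0\le s<t\le T$, the conditional law of $\mathbf x_t$ given $\mathcal F_s$ has density $p(\,\cdot\mid\mathbf x_s)$. 2. For every $\gamma>0$ there is exactly one optimal feedback controller $U_\gamma$, and for all $t\in[0,T)$, $x\in\mathbb R^d$, $$\lim_{\gamma\to\infty}U_\gamma(t,x)=U_\infty(t,x)=g_t\,\nabla_x\log p(x_T\mid x_t=x).$$ 3. On $[0,T)$ the controlled forward SDE $d\mathbf x_t=\big(f_t\mathbf x_t+h_t\mathbf m+g_tU_\infty(t,\mathbf x_t)\big)dt+g_t\,d\mathbf w_t$ has the same drift and diffusion coefficient as Doob's $h$-transform $d\mathbf x_t=\big(f_t\mathbf x_t+h_t\mathbf m+g_t^2\nabla_{\mathbf x_t}\log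 p(x_T\mid\mathbf x_t)\big)dt+g_t\,d\mathbf w_t$. 4. Let $\nu$ be any probability measure on $\mathbb R^d$ (the law of $x_0$ given $x_T$), and for $t\in(0,T)$ put $p(x_t\mid x_T)=\int \frac{p(x_t\mid x_0)\,p(x_T\mid x_t)}{p(x_T\mid x_0)}\,\nu(dx_0)$, the conditional density of $x_t$ given $x_T$. This function of $x_t$ is continuous, positive and differentiable. For every weak solution on $[0,T)$ of the controlled forward SDE in 3 with $\mathbf x_0\sim\nu$ and every $t\in(0,T)$, it is the density of the law of $\mathbf x_t$. Consequently, if $q_t$ denotes the continuous density of the law of such a solution at time $t$, the reverse SDE of the controlled forward SDE, whose drift is $f_tx+h_t\mathbf m+g_tU_\infty(t,x)-g_t^2\nabla\log q_t(x)$ and whose diffusion coefficient is $g_t$, has on $(0,T)$ the same coefficients as the reverse bridge SDE $$d\mathbf x_t=\big[f_t\mathbf x_t+h_t\mathbf m+g_t^2\nabla_{\mathbf x_t}\log p(x_T\mid\mathbf x_t)-g_t^2\nabla_{\mathbf x_t}\log p(\mathbf x_t\mid x_T)\big]dt+g_t\,d\tilde{\mathbf w}_t .$$ 5. Fix $x_0\in\mathbb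 R^d$ and, for each $\gamma>0$, let $u^*_{\cdot,\gamma}$ be an optimal control of the problem with initial data $(0,x_0)$ and $\mathbf x_{\cdot,\gamma}$ its trajectory. As $\gamma\to\infty$, $\mathbf x_{t,\gamma}$ converges for every $t\in[0,T]$ to a limit $\mathbf x_{t,\infty}$ with $\mathbf x_{T,\infty}=x_T$, and $u^*_{\cdot,\gamma}$ converges in $L^2([0,T];\mathbb R^d)$ to $u^*_{t,\infty}=g_t\,\nabla_{\mathbf x_t}\log p(x_T\mid\mathbf x_t)\big|_{\mathbf x_t=\mathbf x_{t,\infty}}$, which lies in $L^2$ and whose trajectory from $x_0$ is $\mathbf x_{\cdot,\infty}$. -/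

import Mathlib

open MeasureTheory ProbabilityTheory Filter Topology Set

/-- The data of the linear dynamics `dx = (f_t x + h_t m) dt + g_t dw` on `[0, T]` in `ℝ^d`. -/
structure LinearData (d : ℕ) where
  T : ℝ
  f : ℝ → ℝ
  h : ℝ → ℝ
  g : ℝ → ℝ
  m : EuclideanSpace ℝ (Fin d)

/-! ### The deterministic optimal control problem -/

/-- `X` solves `dX = (f_t X + h_t m + g_t u_t) dt` on `[s, T]` with `X_s = x`. -/
def IsTrajectory {d : ℕ} (D : LinearData d) (u : ℝ → EuclideanSpace ℝ (Fin d)) (s : ℝ)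
    (x : EuclideanSpace ℝ (Fin d)) (X : ℝ → EuclideanSpace ℝ (Fin d)) : Prop :=
  ContinuousOn X (Icc s D.T) ∧
    ∀ t ∈ Icc s D.T, X t = x + ∫ r in s..t, (D.f r • X r + D.h r • D.m + D.g r • u r)

/-- Admissible pairs: a control of finite energy on `[s, T]` together with its trajectory. -/
def IsAdmissiblePair {d : ℕ} (D : LinearData d) (s : ℝ) (x : EuclideanSpace ℝ (Fin d))
    (u X : ℝ → EuclideanSpace ℝ (Fin d)) : Prop :=
  MemLp u 2 (volume.restrict (Icc s D.T)) ∧ IsTrajectory D u s x X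

/-- The cost `∫_s^T ½ ‖u_t‖² dt + (γ / 2) ‖X_T - x_T‖²`. -/
noncomputable def controlCost {d : ℕ} (D : LinearData d) (xT : EuclideanSpace ℝ (Fin d)) (γ s : ℝ)
    (u X : ℝ → EuclideanSpace ℝ (Fin d)) : ℝ :=
  (∫ t in s..D.T, (1 / 2 : ℝ) * ‖u t‖ ^ 2) + γ / 2 * ‖X D.T - xT‖ ^ 2

/-- `u`, with trajectory `X`, minimizes the cost among all admissible pairs started at `(s, x)`.
The control problem with initial state `x₀` is the case `s = 0`, `x = x₀`. -/
def IsOptimalPair {d : ℕ} (D : LinearData d) (xT : EuclideanSpace ℝ (Fin d)) (γ s : ℝ)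
    (x : EuclideanSpace ℝ (Fin d)) (u X : ℝ → EuclideanSpace ℝ (Fin d)) : Prop :=
  IsAdmissiblePair D s x u X ∧
    ∀ v Y, IsAdmissiblePair D s x v Y → controlCost D xT γ s u X ≤ controlCost D xT γ s v Y

/-- `U` is an optimal controller in feedback form: it is continuous on `[0, T] × ℝ^d`, and from
every initial time and state the control `u_t = U (t, X_t)` generated in closed loop is optimal. -/
def IsOptimalFeedback {d : ℕ} (D : LinearData d) (xT : EuclideanSpace ℝ (Fin d)) (γ : ℝ)
    (U : ℝ → EuclideanSpace ℝ (Fin d) → EuclideanSpace ℝ (Fin d)) : Prop :=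
  ContinuousOn (fun q : ℝ × EuclideanSpace ℝ (Fin d) ↦ U q.1 q.2) (Icc 0 D.T ×ˢ univ) ∧
    ∀ s ∈ Ico 0 D.T, ∀ x, ∃ X, IsOptimalPair D xT γ s x (fun t ↦ U t (X t)) X

/-! ### Stochastic differential equations with scalar diffusion coefficient -/

/-- The equation `dx = drift (t, x) dt + diffusion (t) dw` in `ℝ^d`. -/
structure SDE (d : ℕ) where
  drift : ℝ → EuclideanSpace ℝ (Fin d) → EuclideanSpace ℝ (Fin d)
  diffusion : ℝ → ℝ

/-- The generator `L_t φ = drift · ∇φ + ½ diffusion² Δφ`. -/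
noncomputable def SDE.generator {d : ℕ} (S : SDE d) (t : ℝ) (φ : EuclideanSpace ℝ (Fin d) → ℝ)
    (x : EuclideanSpace ℝ (Fin d)) : ℝ :=
  fderiv ℝ φ x (S.drift t x) + (S.diffusion t) ^ 2 / 2 * Laplacian.laplacian φ x

/-- `X` is a weak solution of `S` on the time interval `I` with respect to the filtration `ℱ` and
the probability measure `P`: a continuous adapted process that solves the martingale problem for
the generator, i.e. `φ (X_t) - φ (X_s) - ∫_s^t L_r φ (X_r) dr` is integrable with vanishing
conditional expectation given `ℱ_s`, for all `s ≤ t` in `I` and all smooth compactly supported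
`φ`. -/
structure IsWeakSolution {d : ℕ} (S : SDE d) (I : Set ℝ) {Ω : Type} {mΩ : MeasurableSpace Ω}
    (ℱ : Filtration ℝ mΩ) (P : Measure Ω) (X : ℝ → Ω → EuclideanSpace ℝ (Fin d)) : Prop where
  isProbabilityMeasure : IsProbabilityMeasure P
  adapted : ∀ t ∈ I, Measurable[ℱ t] (X t)
  continuousOn : ∀ ω, ContinuousOn (fun t ↦ X t ω) I
  integrable : ∀ φ : EuclideanSpace ℝ (Fin d) → ℝ, ContDiff ℝ (⊤ : ℕ∞) φ → HasCompactSupport φ →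
    ∀ s ∈ I, ∀ t ∈ I, s ≤ t →
      Integrable (fun ω ↦ φ (X t ω) - φ (X s ω) - ∫ r in s..t, S.generator r φ (X r ω)) P
  condExp_eq_zero : ∀ φ : EuclideanSpace ℝ (Fin d) → ℝ, ContDiff ℝ (⊤ : ℕ∞) φ → HasCompactSupport φ →
    ∀ s ∈ I, ∀ t ∈ I, s ≤ t →
      P[fun ω ↦ φ (X t ω) - φ (X s ω) - ∫ r in s..t, S.generator r φ (X r ω) | ℱ s] =ᵐ[P] 0

/-- `p s x t y` is the transition density `p(x_t = y | x_s = x)` of `S` on `[0, T]`: for every weak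
solution and `s < t`, the conditional law of `X_t` given `ℱ_s` is `p s (X_s) t y dy`. -/
def IsTransitionDensity {d : ℕ} (S : SDE d) (T : ℝ)
    (p : ℝ → EuclideanSpace ℝ (Fin d) → ℝ → EuclideanSpace ℝ (Fin d) → ℝ) : Prop :=
  ∀ (Ω : Type) (mΩ : MeasurableSpace Ω) (ℱ : Filtration ℝ mΩ) (P : Measure Ω)
    (X : ℝ → Ω → EuclideanSpace ℝ (Fin d)), IsWeakSolution S (Icc 0 T) ℱ P X →
    ∀ s t, 0 ≤ s → s < t → t ≤ T → ∀ B : Set (EuclideanSpace ℝ (Fin d)), MeasurableSet B →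
      P[(X t ⁻¹' B).indicator (fun _ ↦ (1 : ℝ)) | ℱ s] =ᵐ[P] fun ω ↦ ∫ y in B, p s (X s ω) t y

/-- `q t` is, for each `t ∈ I`, the continuous density of the law of `X_t`. -/
def IsMarginalDensity {d : ℕ} {Ω : Type} {mΩ : MeasurableSpace Ω} (P : Measure Ω)
    (X : ℝ → Ω → EuclideanSpace ℝ (Fin d)) (I : Set ℝ)
    (q : ℝ → EuclideanSpace ℝ (Fin d) → ℝ) : Prop :=
  ∀ t ∈ I, Continuous (q t) ∧ (∀ x, 0 ≤ q t x) ∧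
    P.map (X t) = volume.withDensity (fun x ↦ ENNReal.ofReal (q t x))

/-- The reverse-time SDE of `S`, where `q t` is the density of the forward process at time `t`:
the drift is corrected by `- diffusion² ∇ log q_t`, and the noise is a reverse-time Brownian
motion. -/
noncomputable def SDE.reverse {d : ℕ} (S : SDE d) (q : ℝ → EuclideanSpace ℝ (Fin d) → ℝ) :
    SDE d where
  drift t x := S.drift t x - (S.diffusion t) ^ 2 • gradient (fun z ↦ Real.log (q t z)) x
  diffusion := S.diffusion

/-! ### The uncontrolled, the controlled and the Doob-transformed linear SDE -/

/-- `dx = (f_t x + h_t m) dt + g_t dw`. -/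
def LinearData.sde {d : ℕ} (D : LinearData d) : SDE d where
  drift t x := D.f t • x + D.h t • D.m
  diffusion := D.g

/-- `dx = (f_t x + h_t m + g_t U (t, x)) dt + g_t dw`. -/
def LinearData.controlledSDE {d : ℕ} (D : LinearData d)
    (U : ℝ → EuclideanSpace ℝ (Fin d) → EuclideanSpace ℝ (Fin d)) : SDE d where
  drift t x := D.f t • x + D.h t • D.m + D.g t • U t x
  diffusion := D.g

/-- The function `h(x, t, x_T, T) = ∇_x log p(x_T | x_t = x)` of the `h`-transform. -/
noncomputable def doobH {d : ℕ} (T : ℝ)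
    (p : ℝ → EuclideanSpace ℝ (Fin d) → ℝ → EuclideanSpace ℝ (Fin d) → ℝ)
    (xT : EuclideanSpace ℝ (Fin d)) (t : ℝ) (x : EuclideanSpace ℝ (Fin d)) :
    EuclideanSpace ℝ (Fin d) :=
  gradient (fun z ↦ Real.log (p t z T xT)) x

/-- Doob's `h`-transform of `S`, whose transition density is `p`:
`dx = (drift + g_t² h(x, t, x_T, T)) dt + g_t dw`. -/
noncomputable def SDE.doob {d : ℕ} (S : SDE d) (T : ℝ)
    (p : ℝ → EuclideanSpace ℝ (Fin d) → ℝ → EuclideanSpace ℝ (Fin d) → ℝ)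
    (xT : EuclideanSpace ℝ (Fin d)) : SDE d where
  drift t x := S.drift t x + (S.diffusion t) ^ 2 • doobH T p xT t x
  diffusion := S.diffusion

/-- The conditional density `p(x_t | x_T)` of a process with transition density `p`, where `ν` is
the law of `x_0` given `x_T`: it is the `ν`-average over `x_0` of
`p(x_t | x_0, x_T) = p(x_t | x_0) p(x_T | x_t) / p(x_T | x_0)`. -/
noncomputable def bridgeDensity {d : ℕ} (T : ℝ)
    (p : ℝ → EuclideanSpace ℝ (Fin d) → ℝ → EuclideanSpace ℝ (Fin d) → ℝ)
    (ν : Measure (EuclideanSpace ℝ (Fin d))) (xT : EuclideanSpace ℝ (Fin d)) (t : ℝ)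
    (x : EuclideanSpace ℝ (Fin d)) : ℝ :=
  ∫ x₀, p 0 x₀ t x * p t x T xT / p 0 x₀ T xT ∂ν

/-! ### The Gaussian transition density -/

/-- `∫_s^t f_z dz`. -/
noncomputable def LinearData.fBar {d : ℕ} (D : LinearData d) (s t : ℝ) : ℝ :=
  ∫ z in s..t, D.f z

/-- `∫_s^t exp (- ∫_0^z f) h_z dz`. -/
noncomputable def LinearData.hBar {d : ℕ} (D : LinearData d) (s t : ℝ) : ℝ :=
  ∫ z in s..t, Real.exp (-D.fBar 0 z) * D.h z

/-- `∫_s^t exp (- 2 ∫_0^z f) g_z² dz`. -/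
noncomputable def LinearData.g2Bar {d : ℕ} (D : LinearData d) (s t : ℝ) : ℝ :=
  ∫ z in s..t, Real.exp (-2 * D.fBar 0 z) * D.g z ^ 2

/-- The conditional mean of `x_t` given `x_s = x`. -/
noncomputable def LinearData.condMean {d : ℕ} (D : LinearData d) (s : ℝ)
    (x : EuclideanSpace ℝ (Fin d)) (t : ℝ) : EuclideanSpace ℝ (Fin d) :=
  Real.exp (D.fBar s t) • x + (Real.exp (D.fBar 0 t) * D.hBar s t) • D.m

/-- The conditional variance, in each coordinate, of `x_t` given `x_s`. -/
noncomputable def LinearData.condVar {d : ℕ} (D : LinearData d) (s t : ℝ) : ℝ :=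
  Real.exp (2 * D.fBar 0 t) * D.g2Bar s t

/-- The density at `y` of the Gaussian law with mean `condMean s x t` and covariance
`condVar s t • 1` on `ℝ^d`. -/
noncomputable def LinearData.gaussianDensity {d : ℕ} (D : LinearData d) (s : ℝ)
    (x : EuclideanSpace ℝ (Fin d)) (t : ℝ) (y : EuclideanSpace ℝ (Fin d)) : ℝ :=
  (2 * Real.pi * D.condVar s t) ^ (-(d : ℝ) / 2) *
    Real.exp (-‖y - D.condMean s x t‖ ^ 2 / (2 * D.condVar s t))

/-!
Both halves of the argument rest on one change of coordinates. In `y = straighten t x`, that is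
`y = e^{-f̄_t} x - h̄_{0:t} m`, the uncontrolled equation is `dy = k_t dw` and the controlled
dynamics are `dy = k_t u_t dt`, with `k_t = e^{-f̄_t} g_t`. Write `G_t = ∫_t^T k²` for the remaining
variance and `y_T` for the coordinate of the target `x_T` at time `T`.

*Laws.* Let the drift of an equation be affine, and let `Y = l X + c` be a coordinate in which it
vanishes. The martingale problem then gives, for test functions `Φ`, that `E[1_A Φ(Y_r)]` has
derivative `½ l² g² E[1_A ΔΦ(Y_r)]` (`IsWeakSolution.hasDerivWithinAt_setIntegral`). As there is no
first-order term, this extends by truncation to plane waves, no moments of `X` being needed, and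
yields the conditional characteristic function of `Y` (`IsWeakSolution.charFun_map_restrict`):
given `ℱ_s`, the variable `X_t` is Gaussian (`IsWeakSolution.restrict_apply_preimage`). With the
coordinate `y` this is the transition density. The score of the Gaussian density is
`∇ log p(x_T | x_t) = e^{-f̄_t} (y_T - y_t) / G_t`, so the drift of the `h`-transform is again affine,
with driftless coordinate `(y - y_T) / G_t`. Hence its marginals are Gaussian mixtures
(`LinearData.IsRegular.bridge_law`), which Bayes' formula identifies with the bridge density
(`LinearData.IsRegular.gaussianDensity_mul_div`).

*Control.* In the coordinate `y` the problem is to minimize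
`½ ∫ ‖u‖² + ½ γ e^{2 f̄_T} ‖y_s + ∫ k u - y_T‖²`. Completing the square
(`LinearData.IsRegular.controlCost_eq`) shows that the unique minimizer is `u = k p`, where the
constant vector `p` is `γ (y_T - y_s) / (e^{-2 f̄_T} + γ G_s)`. This `p` is conserved along the
optimal trajectory, so `k_t p(t, x)` is the optimal feedback. As `γ → ∞`, `p` tends to
`(y_T - y_s) / G_s`, which turns the feedback into `g ∇ log p` and the optimal trajectory into the
straight line from `y_0` to `y_T`, traversed at the speed of the accumulated variance.
-/

/-! ### The isotropic Gaussian density and its characteristic function -/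

/-- The density at `y` of the Gaussian law `N(μ, v I)` on `ℝ^d`. Its value at `v ≤ 0` is junk. -/
noncomputable def isoGaussianPDF {d : ℕ} (v : ℝ) (μ y : EuclideanSpace ℝ (Fin d)) : ℝ :=
  (2 * Real.pi * v) ^ (-(d : ℝ) / 2) * Real.exp (-‖y - μ‖ ^ 2 / (2 * v))

section Gaussian
variable {d : ℕ} {v : ℝ}

lemma isoGaussianPDF_pos (hv : 0 < v) (μ y : EuclideanSpace ℝ (Fin d)) :
    0 < isoGaussianPDF v μ y := by
  unfold isoGaussianPDF; positivity

lemma Continuous.isoGaussianPDF {α : Type*} [TopologicalSpace α]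
    {μ y : α → EuclideanSpace ℝ (Fin d)} (hμ : Continuous μ) (hy : Continuous y) :
    Continuous fun a ↦ isoGaussianPDF v (μ a) (y a) := by
  unfold _root_.isoGaussianPDF; fun_prop

lemma measurable_ofReal_isoGaussianPDF (v : ℝ) (μ : EuclideanSpace ℝ (Fin d)) :
    Measurable fun y ↦ ENNReal.ofReal (isoGaussianPDF v μ y) :=
  (continuous_const.isoGaussianPDF continuous_id).measurable.ennreal_ofReal

lemma isoGaussianPDF_le (hv : 0 < v) (μ y : EuclideanSpace ℝ (Fin d)) :
    isoGaussianPDF v μ y ≤ (2 * Real.pi * v) ^ (-(d : ℝ) / 2) := by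
  unfold isoGaussianPDF
  refine mul_le_of_le_one_right (by positivity) (Real.exp_le_one_iff.2 ?_)
  rw [neg_div]; exact neg_nonpos.2 (by positivity)

lemma isoGaussianPDF_eq_sub (v : ℝ) (μ y : EuclideanSpace ℝ (Fin d)) :
    isoGaussianPDF v μ y = isoGaussianPDF v 0 (y - μ) := by
  simp [isoGaussianPDF]

lemma integrable_isoGaussianPDF (hv : 0 < v) (μ : EuclideanSpace ℝ (Fin d)) :
    Integrable (isoGaussianPDF v μ) := by
  have h0 : Integrable (isoGaussianPDF v (0 : EuclideanSpace ℝ (Fin d))) := by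
    have h := GaussianFourier.integrable_cexp_neg_mul_sq_norm_add
      (V := EuclideanSpace ℝ (Fin d)) (b := ((1 / (2 * v) : ℝ) : ℂ))
      (by rw [Complex.ofReal_re]; positivity) 0 0
    have h2 := (h.re.const_mul ((2 * Real.pi * v) ^ (-(d : ℝ) / 2)))
    refine h2.congr (Eventually.of_forall fun y ↦ ?_)
    have : -((1 / (2 * v) : ℝ) : ℂ) * (‖y‖ : ℂ) ^ 2
          + 0 * (inner ℝ (0 : EuclideanSpace ℝ (Fin d)) y : ℂ)
        = ((-‖y‖ ^ 2 / (2 * v) : ℝ) : ℂ) := by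
      push_cast; ring
    simp only [isoGaussianPDF, sub_zero]
    rw [this, ← Complex.ofReal_exp, RCLike.re_eq_complex_re, Complex.ofReal_re]
  have := h0.comp_sub_right μ
  exact this.congr (Eventually.of_forall fun y ↦ (isoGaussianPDF_eq_sub v μ y).symm)

lemma integrable_isoGaussianPDF_comp (hv : 0 < v)
    {M : EuclideanSpace ℝ (Fin d) → EuclideanSpace ℝ (Fin d)} (hM : Continuous M)
    (ν : Measure (EuclideanSpace ℝ (Fin d))) [IsFiniteMeasure ν]
    (x : EuclideanSpace ℝ (Fin d)) : Integrable (fun x₀ ↦ isoGaussianPDF v (M x₀) x) ν := by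
  refine Integrable.of_bound (C := (2 * Real.pi * v) ^ (-(d : ℝ) / 2))
    (hM.isoGaussianPDF continuous_const).aestronglyMeasurable (Eventually.of_forall fun x₀ ↦ ?_)
  rw [Real.norm_of_nonneg (isoGaussianPDF_pos hv _ x).le]
  exact isoGaussianPDF_le hv _ x

lemma integral_isoGaussianPDF_mul_cexp (hv : 0 < v) (ξ : EuclideanSpace ℝ (Fin d)) :
    ∫ y, (isoGaussianPDF v 0 y : ℂ) * Complex.exp (inner ℝ y ξ * Complex.I)
      = Complex.exp (-(v * ‖ξ‖ ^ 2 / 2 : ℝ)) := by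
  have h := GaussianFourier.integral_cexp_neg_mul_sq_norm_add
      (V := EuclideanSpace ℝ (Fin d)) (b := ((1 / (2 * v) : ℝ) : ℂ))
      (by rw [Complex.ofReal_re]; positivity) Complex.I ξ
  have h1 : ∀ y : EuclideanSpace ℝ (Fin d),
      (isoGaussianPDF v 0 y : ℂ) * Complex.exp (inner ℝ y ξ * Complex.I)
        = ((2 * Real.pi * v) ^ (-(d : ℝ) / 2) : ℝ) *
        Complex.exp (-((1 / (2 * v) : ℝ) : ℂ) * (‖y‖ : ℂ) ^ 2 + Complex.I * inner ℝ ξ y) := by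
    intro y
    rw [isoGaussianPDF, Complex.ofReal_mul, mul_assoc, Complex.ofReal_exp, ← Complex.exp_add,
      real_inner_comm]
    congr 2
    push_cast; simp only [sub_zero]; ring
  simp_rw [h1]
  rw [integral_const_mul, h, ← mul_assoc]
  have h2 : (((2 * Real.pi * v) ^ (-(d : ℝ) / 2) : ℝ) : ℂ) *
      ((Real.pi : ℂ) / ((1 / (2 * v) : ℝ) : ℂ)) ^
        ((Module.finrank ℝ (EuclideanSpace ℝ (Fin d)) : ℂ) / 2) = 1 := by
    have : ((Real.pi : ℂ) / ((1 / (2 * v) : ℝ) : ℂ)) ^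
        ((Module.finrank ℝ (EuclideanSpace ℝ (Fin d)) : ℂ) / 2)
        = (((2 * Real.pi * v) ^ ((d : ℝ) / 2) : ℝ) : ℂ) := by
      rw [Complex.ofReal_cpow (by positivity)]
      simp only [finrank_euclideanSpace, Fintype.card_fin]
      push_cast
      congr 1
      field_simp
    rw [this, ← Complex.ofReal_mul, ← Real.rpow_add (by positivity)]
    norm_num
    simp [neg_div]
  rw [h2, one_mul]
  congr 1
  push_cast
  simp only [Complex.I_sq]
  field_simp
  ring

/-- The centred isotropic Gaussian measure `N(0, v I)`. -/
noncomputable def isoGaussian (d : ℕ) (v : ℝ) : Measure (EuclideanSpace ℝ (Fin d)) :=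
  volume.withDensity fun y ↦ ENNReal.ofReal (isoGaussianPDF v 0 y)

lemma isFiniteMeasure_isoGaussian (hv : 0 < v) : IsFiniteMeasure (isoGaussian d v) :=
  isFiniteMeasure_withDensity_ofReal (integrable_isoGaussianPDF hv 0).2

lemma charFun_isoGaussian (hv : 0 < v) (ξ : EuclideanSpace ℝ (Fin d)) :
    charFun (isoGaussian d v) ξ = Complex.exp (-(v * ‖ξ‖ ^ 2 / 2 : ℝ)) := by
  rw [charFun_apply, isoGaussian, integral_withDensity_eq_integral_toReal_smul
    (measurable_ofReal_isoGaussianPDF v 0)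
    (Eventually.of_forall fun _ ↦ ENNReal.ofReal_lt_top), ← integral_isoGaussianPDF_mul_cexp hv]
  refine integral_congr_ae (Eventually.of_forall fun y ↦ ?_)
  simp only [ENNReal.toReal_ofReal (isoGaussianPDF_pos hv 0 y).le, Complex.real_smul]

/-- If the characteristic function of `Y` under `ρ` is that of `Z` times that of `N(0, v I)`, then
the law of `Y` is the mixture of the laws `N(Z, v I)`. -/
lemma map_apply_of_charFun_eq {Ω : Type*} {mΩ : MeasurableSpace Ω} {ρ : Measure Ω}
    [IsFiniteMeasure ρ] (hv : 0 < v) {Y Z : Ω → EuclideanSpace ℝ (Fin d)} (hY : Measurable Y)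
    (hZ : Measurable Z)
    (h : ∀ ξ, charFun (ρ.map Y) ξ = charFun (ρ.map Z) ξ * Complex.exp (-(v * ‖ξ‖ ^ 2 / 2 : ℝ)))
    {B : Set (EuclideanSpace ℝ (Fin d))} (hB : MeasurableSet B) :
    ρ (Y ⁻¹' B) = ∫⁻ ω, (∫⁻ y in B, ENNReal.ofReal (isoGaussianPDF v (Z ω) y)) ∂ρ := by
  have := isFiniteMeasure_isoGaussian (d := d) hv
  have hlaw : ρ.map Y = (ρ.map Z) ∗ isoGaussian d v := by
    refine Measure.ext_of_charFun ?_
    ext ξ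
    rw [h, charFun_conv, charFun_isoGaussian hv]
  rw [← Measure.map_apply hY hB, hlaw, ← lintegral_indicator_one hB,
    Measure.lintegral_conv (measurable_one.indicator hB), lintegral_map _ hZ]
  · refine lintegral_congr fun ω ↦ ?_
    have hi : Measurable fun y ↦ B.indicator (1 : EuclideanSpace ℝ (Fin d) → ENNReal) (Z ω + y) :=
      (measurable_one.indicator hB).comp (measurable_const_add _)
    have e1 := lintegral_withDensity_eq_lintegral_mul volume
      (measurable_ofReal_isoGaussianPDF v 0) hi
    have e2 := lintegral_indicator (μ := volume) hB
      (fun y ↦ ENNReal.ofReal (isoGaussianPDF v (Z ω) y))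
    have e3 := lintegral_add_left_eq_self (μ := volume)
      (B.indicator fun y ↦ ENNReal.ofReal (isoGaussianPDF v (Z ω) y)) (Z ω)
    refine e1.trans (Eq.trans ?_ (e3.trans e2))
    refine lintegral_congr fun y ↦ ?_
    rw [Pi.mul_apply]
    by_cases hy : Z ω + y ∈ B
    · rw [indicator_of_mem hy, indicator_of_mem hy, isoGaussianPDF_eq_sub v (Z ω),
        add_sub_cancel_left, Pi.one_apply, mul_one]
    · rw [indicator_of_notMem hy, indicator_of_notMem hy, mul_zero]
  · exact Measurable.lintegral_prod_right' ((measurable_one.indicator hB).comp measurable_add)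

end Gaussian

/-! ### Laplacians of dilations, plane waves and truncations -/

section Laplacian
variable {d : ℕ}
open Laplacian InnerProductSpace

lemma abs_laplacian_le (u : EuclideanSpace ℝ (Fin d) → ℝ) (y : EuclideanSpace ℝ (Fin d)) :
    |Laplacian.laplacian u y| ≤ d * ‖iteratedFDeriv ℝ 2 u y‖ := by
  rw [laplacian_eq_iteratedFDeriv_orthonormalBasis u (EuclideanSpace.basisFun (Fin d) ℝ)]
  refine (Finset.abs_sum_le_sum_abs _ _).trans ?_
  refine (Finset.sum_le_card_nsmul _ _ ‖iteratedFDeriv ℝ 2 u y‖ fun i _ ↦ ?_).trans_eq (by simp)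
  refine ((iteratedFDeriv ℝ 2 u y).le_opNorm _).trans_eq ?_
  simp [Fin.prod_univ_two]

lemma continuous_laplacian {u : EuclideanSpace ℝ (Fin d) → ℝ} (hu : ContDiff ℝ (⊤ : ℕ∞) u) :
    Continuous (Laplacian.laplacian u) := by
  rw [laplacian_eq_iteratedFDeriv_orthonormalBasis u (EuclideanSpace.basisFun (Fin d) ℝ)]
  have h : Continuous (iteratedFDeriv ℝ 2 u) :=
    (contDiff_infty.1 hu 2).continuous_iteratedFDeriv le_rfl
  refine continuous_finsetSum _ fun i _ ↦ ?_
  exact (ContinuousMultilinearMap.apply ℝ (fun _ : Fin 2 ↦ EuclideanSpace ℝ (Fin d)) ℝ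
    ![EuclideanSpace.basisFun (Fin d) ℝ i, EuclideanSpace.basisFun (Fin d) ℝ i]).continuous.comp h

lemma iteratedFDeriv_comp_homothety {u : EuclideanSpace ℝ (Fin d) → ℝ}
    (hu : ContDiff ℝ (⊤ : ℕ∞) u) (l : ℝ) (c y : EuclideanSpace ℝ (Fin d)) (n : ℕ) :
    iteratedFDeriv ℝ n (fun z ↦ u (l • z + c)) y = l ^ n • iteratedFDeriv ℝ n u (l • y + c) := by
  have h := iteratedFDeriv_comp_add_right (𝕜 := ℝ) (f := u) n c (l • y)
  have h2 := ContinuousLinearMap.iteratedFDeriv_comp_right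
    (l • ContinuousLinearMap.id ℝ (EuclideanSpace ℝ (Fin d))) (f := fun z ↦ u (z + c))
    (n := (⊤ : ℕ∞))
    (hu.comp (by fun_prop)) y (i := n) (by exact_mod_cast le_top)
  have e : (fun z ↦ u (l • z + c)) = (fun z ↦ u (z + c)) ∘
    (l • ContinuousLinearMap.id ℝ (EuclideanSpace ℝ (Fin d))) := by ext; simp
  rw [e, h2]
  ext m
  simp only [ContinuousMultilinearMap.compContinuousLinearMap_apply, smul_apply,
    ContinuousLinearMap.id_apply]
  rw [h, ContinuousMultilinearMap.map_smul_univ]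
  simp

lemma laplacian_comp_homothety {u : EuclideanSpace ℝ (Fin d) → ℝ}
    (hu : ContDiff ℝ (⊤ : ℕ∞) u) (l : ℝ) (c y : EuclideanSpace ℝ (Fin d)) :
    Laplacian.laplacian (fun z ↦ u (l • z + c)) y = l ^ 2 * Laplacian.laplacian u (l • y + c) := by
  simp only [laplacian_eq_iteratedFDeriv_orthonormalBasis _ (EuclideanSpace.basisFun (Fin d) ℝ),
    iteratedFDeriv_comp_homothety hu, Finset.mul_sum, smul_apply,
    smul_eq_mul]

lemma iteratedFDeriv_comp_inner {w : ℝ → ℝ} (hw : ContDiff ℝ (⊤ : ℕ∞) w)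
    (ξ y : EuclideanSpace ℝ (Fin d)) (n : ℕ) :
    iteratedFDeriv ℝ n (fun z ↦ w (inner ℝ z ξ)) y =
      (iteratedFDeriv ℝ n w (inner ℝ y ξ)).compContinuousLinearMap fun _ ↦ innerSL ℝ ξ := by
  have h2 := ContinuousLinearMap.iteratedFDeriv_comp_right
    (innerSL ℝ ξ) (f := w) (n := (⊤ : ℕ∞)) hw y (i := n) (by exact_mod_cast le_top)
  have e : (fun z ↦ w (inner ℝ z ξ)) = w ∘ (innerSL ℝ ξ) := by
    ext z; simp [real_inner_comm]
  rw [e, h2]; simp [real_inner_comm]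

lemma laplacian_comp_inner {w : ℝ → ℝ} (hw : ContDiff ℝ (⊤ : ℕ∞) w)
    (ξ y : EuclideanSpace ℝ (Fin d)) :
    Laplacian.laplacian (fun z ↦ w (inner ℝ z ξ)) y
      = ‖ξ‖ ^ 2 * iteratedDeriv 2 w (inner ℝ y ξ) := by
  simp only [laplacian_eq_iteratedFDeriv_orthonormalBasis _ (EuclideanSpace.basisFun (Fin d) ℝ),
    iteratedFDeriv_comp_inner hw, ContinuousMultilinearMap.compContinuousLinearMap_apply,
    iteratedFDeriv_apply_eq_iteratedDeriv_mul_prod, EuclideanSpace.norm_sq_eq, Finset.sum_mul]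
  refine Finset.sum_congr rfl fun i _ ↦ ?_
  simp [Fin.prod_univ_two, EuclideanSpace.inner_single_right]
  left; ring

/-- Truncation: a smooth function with bounded derivatives up to order two is the eventually
constant pointwise limit of test functions that are bounded together with their Laplacians. -/
lemma exists_compactSupport_approx {u : EuclideanSpace ℝ (Fin d) → ℝ}
    (hu : ContDiff ℝ (⊤ : ℕ∞) u) {C : ℝ} (hC : ∀ i ≤ 2, ∀ y, ‖iteratedFDeriv ℝ i u y‖ ≤ C) :
    ∃ Φ : ℕ → EuclideanSpace ℝ (Fin d) → ℝ, (∀ n, ContDiff ℝ (⊤ : ℕ∞) (Φ n)) ∧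
      (∀ n, HasCompactSupport (Φ n)) ∧
      (∃ K, ∀ n y, |Φ n y| ≤ K ∧ |Laplacian.laplacian (Φ n) y| ≤ K) ∧
      ∀ y, ∀ᶠ n in atTop, Φ n y = u y ∧ Laplacian.laplacian (Φ n) y = Laplacian.laplacian u y := by
  let χ : ContDiffBump (0 : EuclideanSpace ℝ (Fin d)) := ⟨1, 2, one_pos, one_lt_two⟩
  have hχ : ContDiff ℝ (⊤ : ℕ∞) χ := χ.contDiff
  let a : ℕ → ℝ := fun n ↦ 1 / ((n : ℝ) + 1)
  have ha : ∀ n, 0 < a n := fun n ↦ by positivity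
  have ha1 : ∀ n, a n ≤ 1 := fun n ↦ by
    simp only [a]; rw [div_le_one (by positivity)]; linarith [(Nat.cast_nonneg n : (0 : ℝ) ≤ n)]
  let θ : ℕ → EuclideanSpace ℝ (Fin d) → ℝ := fun n y ↦ χ (a n • y + 0)
  have hθ : ∀ n, ContDiff ℝ (⊤ : ℕ∞) (θ n) := fun n ↦ hχ.comp (by fun_prop)
  have hθs : ∀ n, HasCompactSupport (θ n) := fun n ↦ by
    simpa [θ] using χ.hasCompactSupport.comp_smul (ha n).ne'
  have hb : ∀ i : ℕ, ∃ M, ∀ y, ‖iteratedFDeriv ℝ i χ y‖ ≤ M := fun i ↦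
    (χ.hasCompactSupport.iteratedFDeriv i).exists_bound_of_continuous
      (hχ.continuous_iteratedFDeriv (by exact_mod_cast le_top))
  choose M hM using hb
  have hM0 : ∀ i, 0 ≤ M i := fun i ↦ (norm_nonneg _).trans (hM i 0)
  have hθb : ∀ n i y, ‖iteratedFDeriv ℝ i (θ n) y‖ ≤ M i := fun n i y ↦ by
    rw [iteratedFDeriv_comp_homothety hχ, norm_smul]
    refine (mul_le_of_le_one_left (norm_nonneg _) ?_).trans (hM i _)
    rw [norm_pow, Real.norm_of_nonneg (ha n).le]
    exact pow_le_one₀ (ha n).le (ha1 n)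
  have hC0 : 0 ≤ C := (norm_nonneg _).trans (hC 0 (by norm_num) 0)
  have key : ∀ k ≤ 2, ∀ n y, ‖iteratedFDeriv ℝ k (fun z ↦ θ n z * u z) y‖ ≤
      ∑ i ∈ Finset.range (k + 1), (k.choose i : ℝ) * M i * C := fun k hk n y ↦ by
    refine (norm_iteratedFDeriv_mul_le (N := (⊤ : ℕ∞)) (hθ n) hu y
      (by exact_mod_cast le_top)).trans ?_
    refine Finset.sum_le_sum fun i hi ↦ ?_
    gcongr
    · exact mul_nonneg (Nat.cast_nonneg _) (hM0 i)
    · exact hθb n i y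
    · exact hC _ (by omega) y
  let K₀ : ℝ := ∑ i ∈ Finset.range (0 + 1), ((0 : ℕ).choose i : ℝ) * M i * C
  let K₂ : ℝ := d * ∑ i ∈ Finset.range (2 + 1), ((2 : ℕ).choose i : ℝ) * M i * C
  refine ⟨fun n y ↦ θ n y * u y, fun n ↦ (hθ n).mul hu, fun n ↦ (hθs n).mul_right,
    ⟨max K₀ K₂, fun n y ↦ ⟨le_max_of_le_left ?_, le_max_of_le_right ?_⟩⟩, fun y ↦ ?_⟩
  · have := key 0 (by norm_num) n y
    rwa [norm_iteratedFDeriv_zero, Real.norm_eq_abs] at this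
  · exact (abs_laplacian_le _ y).trans 
      (mul_le_mul_of_nonneg_left (key 2 le_rfl n y) (Nat.cast_nonneg d))
  · have hlim : Tendsto (fun n ↦ a n * (‖y‖ + 1)) atTop (𝓝 (0 * (‖y‖ + 1))) :=
      tendsto_one_div_add_atTop_nhds_zero_nat.mul_const _
    rw [zero_mul] at hlim
    filter_upwards [hlim.eventually (gt_mem_nhds one_pos)] with n hn
    have he : (fun z ↦ θ n z * u z) =ᶠ[𝓝 y] u := by
      filter_upwards [Metric.ball_mem_nhds y one_pos] with z hz
      have : θ n z = 1 := by
        refine χ.one_of_mem_closedBall ?_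
        rw [add_zero, mem_closedBall_zero_iff, norm_smul, Real.norm_of_nonneg (ha n).le]
        refine le_trans ?_ hn.le
        have : ‖z‖ ≤ ‖y‖ + 1 := by
          have h1 := norm_le_norm_add_norm_sub y z
          rw [mem_ball_iff_norm, norm_sub_rev] at hz
          linarith
        gcongr
      rw [this, one_mul]
    exact ⟨he.eq_of_nhds, (laplacian_congr_nhds he).eq_of_nhds⟩

end Laplacian

/-! ### One-sided calculus and difference quotients in a moving frame -/

lemma HasDerivWithinAt.tendsto_slope_right {F : Type*} [NormedAddCommGroup F]
    [NormedSpace ℝ F] {φ : ℝ → F} {φ' : F} {r : ℝ}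
    (h : HasDerivWithinAt φ φ' (Ici r) r) :
    Tendsto (fun q ↦ (q - r)⁻¹ • (φ q - φ r)) (𝓝[>] r) (𝓝 φ') :=
  (hasDerivWithinAt_iff_tendsto_slope' self_notMem_Ioi).1 (hasDerivWithinAt_Ioi_iff_Ici.2 h)

section Primitive
variable {F : Type*} [NormedAddCommGroup F] [NormedSpace ℝ F] [CompleteSpace F]

/-- The fundamental theorem of calculus with one-sided derivatives, which needs continuity of the
integrand on the closed interval only. -/
lemma hasDerivWithinAt_primitive {φ : ℝ → F} {a b : ℝ} (hφ : ContinuousOn φ (Icc a b)) {s r : ℝ}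
    (hs : s ∈ Icc a b) (hr : r ∈ Ico a b) :
    HasDerivWithinAt (fun q ↦ ∫ u in s..q, φ u) (φ r) (Ici r) r := by
  have hr' : r ∈ Icc a b := Ico_subset_Icc_self hr
  have hsub : Icc r b ⊆ Icc a b := Icc_subset_Icc_left hr.1
  have hnh : Icc r b ∈ 𝓝[>] r := Icc_mem_nhdsGT hr.2
  refine intervalIntegral.integral_hasDerivWithinAt_right
    ((hφ.mono (uIcc_subset_Icc hs hr')).intervalIntegrable) ?_ (t := Ioi r) ?_
  · exact ⟨Icc r b, hnh, (hφ.mono hsub).aestronglyMeasurable measurableSet_Icc⟩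
  · have : ContinuousWithinAt φ (Icc r b) r := (hφ.mono hsub) r (left_mem_Icc.2 hr.2.le)
    exact this.mono_of_mem_nhdsWithin hnh

lemma integral_eq_sub_of_hasDerivWithinAt_Ici {m n : ℝ → F} {a b : ℝ} (hab : a ≤ b)
    (hm : ContinuousOn m (Icc a b)) (hn : ContinuousOn n (Icc a b))
    (h : ∀ r ∈ Ico a b, HasDerivWithinAt m (n r) (Ici r) r) :
    ∫ r in a..b, n r = m b - m a :=
  intervalIntegral.integral_eq_sub_of_hasDeriv_right_of_le hab hm
    (fun r hr ↦ (h r ⟨hr.1.le, hr.2⟩).mono Ioi_subset_Ici_self)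
    (hn.intervalIntegrable_of_Icc hab)

end Primitive

section MovingFrame
variable {d : ℕ}

/-- Along a path `x`, the part of the increment of `Φ (l x + c)` that is due to the motion of the
frame `(l, c)` has the expected right derivative. Only strict differentiability of `Φ` is used, so
that the path need not be differentiable. -/
lemma tendsto_slope_moving_frame {Φ : EuclideanSpace ℝ (Fin d) → ℝ} (hΦ : ContDiff ℝ (⊤ : ℕ∞) Φ)
    {l : ℝ → ℝ} {c x : ℝ → EuclideanSpace ℝ (Fin d)} {l' r : ℝ} {c' : EuclideanSpace ℝ (Fin d)}
    (hl : HasDerivWithinAt l l' (Ici r) r) (hc : HasDerivWithinAt c c' (Ici r) r)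
    (hx : Tendsto x (𝓝[>] r) (𝓝 (x r))) :
    Tendsto (fun q ↦ (q - r)⁻¹ * (Φ (l q • x q + c q) - Φ (l r • x q + c r))) (𝓝[>] r)
      (𝓝 (fderiv ℝ Φ (l r • x r + c r) (l' • x r + c'))) := by
  set y := l r • x r + c r
  have hstrict : HasStrictFDerivAt Φ (fderiv ℝ Φ y) y :=
    hΦ.contDiffAt.hasStrictFDerivAt (by simp)
  have hl1 : Tendsto l (𝓝[>] r) (𝓝 (l r)) :=
    hl.continuousWithinAt.tendsto.mono_left (nhdsWithin_mono _ Ioi_subset_Ici_self)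
  have hc1 : Tendsto c (𝓝[>] r) (𝓝 (c r)) :=
    hc.continuousWithinAt.tendsto.mono_left (nhdsWithin_mono _ Ioi_subset_Ici_self)
  have hl2 : Tendsto (fun q ↦ (q - r)⁻¹ * (l q - l r)) (𝓝[>] r) (𝓝 l') := hl.tendsto_slope_right
  have hc2 : Tendsto (fun q ↦ (q - r)⁻¹ • (c q - c r)) (𝓝[>] r) (𝓝 c') := hc.tendsto_slope_right
  have hpair : Tendsto (fun q ↦ (l q • x q + c q, l r • x q + c r)) (𝓝[>] r) (𝓝 (y, y)) :=
    ((hl1.smul hx).add hc1).prodMk_nhds ((hx.const_smul _).add_const _)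
  have hlim : Tendsto (fun q ↦ (q - r)⁻¹ • ((l q • x q + c q) - (l r • x q + c r))) (𝓝[>] r)
      (𝓝 (l' • x r + c')) := by
    refine ((hl2.smul hx).add hc2).congr fun q ↦ ?_
    rw [mul_smul, ← smul_add]; congr 1; module
  have ho := (hstrict.isLittleO.comp_tendsto hpair)
  have ho2 := (Asymptotics.isBigO_refl (fun q ↦ (q - r)⁻¹) (𝓝[>] r)).smul_isLittleO ho
  have ho3 := ho2.trans_isBigO (hlim.isBigO_one ℝ)
  have ho4 := (Asymptotics.isLittleO_one_iff ℝ).1 ho3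
  have := ho4.add (((fderiv ℝ Φ y).continuous.tendsto _).comp hlim)
  rw [zero_add] at this
  refine this.congr fun q ↦ ?_
  simp only [Function.comp_apply, map_smul, smul_eq_mul]
  ring

/-- The difference quotients of `r ↦ Φ (l r • x + c r)` are bounded uniformly in `x`, since only
those `x` matter that the frame sends into the support of `Φ`. -/
lemma eventually_slope_moving_frame_le {Φ : EuclideanSpace ℝ (Fin d) → ℝ}
    (hΦ : ContDiff ℝ (⊤ : ℕ∞) Φ) (hΦs : HasCompactSupport Φ)
    {l : ℝ → ℝ} {c : ℝ → EuclideanSpace ℝ (Fin d)} {l' r : ℝ} {c' : EuclideanSpace ℝ (Fin d)}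
    (hl : HasDerivWithinAt l l' (Ici r) r) (hc : HasDerivWithinAt c c' (Ici r) r) (hlr : 0 < l r) :
    ∃ K, ∀ᶠ q in 𝓝[>] r, ∀ x,
      |(q - r)⁻¹ * (Φ (l q • x + c q) - Φ (l r • x + c r))| ≤ K := by
  have hl1 : Tendsto l (𝓝[>] r) (𝓝 (l r)) :=
    hl.continuousWithinAt.tendsto.mono_left (nhdsWithin_mono _ Ioi_subset_Ici_self)
  have hc1 : Tendsto c (𝓝[>] r) (𝓝 (c r)) :=
    hc.continuousWithinAt.tendsto.mono_left (nhdsWithin_mono _ Ioi_subset_Ici_self)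
  have hl2 : Tendsto (fun q ↦ (q - r)⁻¹ * (l q - l r)) (𝓝[>] r) (𝓝 l') := hl.tendsto_slope_right
  have hc2 : Tendsto (fun q ↦ (q - r)⁻¹ • (c q - c r)) (𝓝[>] r) (𝓝 c') := hc.tendsto_slope_right
  obtain ⟨L, hL⟩ := (hΦ.of_le (by simp : (1 : WithTop ℕ∞) ≤ _)).lipschitzWith_of_hasCompactSupport
    hΦs one_ne_zero
  obtain ⟨R, hR⟩ := hΦs.isCompact.isBounded.exists_norm_le
  have hout : ∀ y, R < ‖y‖ → Φ y = 0 := fun y hy ↦ by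
    by_contra h
    exact absurd (hR y (subset_tsupport _ h)) (not_le.2 hy)
  set ρ := (R + ‖c r‖ + 1) / (l r / 2)
  refine ⟨L * ((|l'| + 1) * |ρ| + (‖c'‖ + 1)), ?_⟩
  filter_upwards [hl1.eventually (lt_mem_nhds (half_lt_self hlr)),
    hc1.norm.eventually (gt_mem_nhds (lt_add_one _)),
    hl2.abs.eventually (gt_mem_nhds (lt_add_one _)),
    hc2.norm.eventually (gt_mem_nhds (lt_add_one _))] with q h1 h2 h3 h4 x
  -- `Φ` is Lipschitz; for `‖x‖ > ρ` both points lie outside its support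
  by_cases hx : ‖x‖ ≤ ρ
  · have e : (q - r)⁻¹ • ((l q • x + c q) - (l r • x + c r))
        = ((q - r)⁻¹ * (l q - l r)) • x + (q - r)⁻¹ • (c q - c r) := by
      rw [mul_smul, ← smul_add]; congr 1; module
    rw [abs_mul]
    calc |(q - r)⁻¹| * |Φ (l q • x + c q) - Φ (l r • x + c r)|
        ≤ |(q - r)⁻¹| * (L * ‖(l q • x + c q) - (l r • x + c r)‖) := by
          gcongr; exact hL.norm_sub_le _ _
      _ = L * ‖(q - r)⁻¹ • ((l q • x + c q) - (l r • x + c r))‖ := by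
          rw [norm_smul, Real.norm_eq_abs]; ring
      _ ≤ _ := by
          rw [e]
          gcongr
          refine (norm_add_le _ _).trans (add_le_add ?_ h4.le)
          rw [norm_smul, Real.norm_eq_abs]
          gcongr
          exact hx.trans (le_abs_self _)
  · push Not at hx
    have hρ : ρ * (l r / 2) = R + ‖c r‖ + 1 := by simp only [ρ]; field_simp
    have hbig : ∀ a : ℝ, ∀ b : EuclideanSpace ℝ (Fin d), l r / 2 < a → ‖b‖ < ‖c r‖ + 1 →
        Φ (a • x + b) = 0 := fun a b ha hb ↦ by
      refine hout _ ?_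
      have h5 : ‖a • x‖ ≤ ‖a • x + b‖ + ‖b‖ := by
        simpa using norm_sub_le (a • x + b) b
      rw [norm_smul, Real.norm_of_nonneg (by linarith)] at h5
      rcases le_or_gt 0 ρ with h0 | h0
      · nlinarith [mul_lt_mul'' hx ha h0 (by linarith)]
      · have : R + ‖c r‖ + 1 < 0 := by rw [← hρ]; exact mul_neg_of_neg_of_pos h0 (by linarith)
        linarith [norm_nonneg (a • x + b), norm_nonneg (c r)]
    rw [hbig _ _ h1 h2, hbig _ _ (half_lt_self hlr) (lt_add_one _)]
    simp only [sub_self, mul_zero, abs_zero]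
    positivity

lemma exists_abs_generator_le {S : SDE d} {s t : ℝ} {α : ℝ → ℝ}
    {β : ℝ → EuclideanSpace ℝ (Fin d)} (hα : ContinuousOn α (Icc s t))
    (hβ : ContinuousOn β (Icc s t)) (hg : ContinuousOn S.diffusion (Icc s t))
    (hdrift : ∀ r ∈ Icc s t, ∀ x, S.drift r x = α r • x + β r)
    {φ : EuclideanSpace ℝ (Fin d) → ℝ} (hφ : ContDiff ℝ (⊤ : ℕ∞) φ) (hφs : HasCompactSupport φ) :
    ∃ K, 0 ≤ K ∧ ∀ r ∈ Icc s t, ∀ x, |S.generator r φ x| ≤ K := by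
  obtain ⟨a, ha⟩ := isCompact_Icc.exists_bound_of_continuousOn hα
  obtain ⟨b, hb⟩ := isCompact_Icc.exists_bound_of_continuousOn hβ
  obtain ⟨c, hc⟩ := isCompact_Icc.exists_bound_of_continuousOn hg
  have hfd : Continuous (fderiv ℝ φ) := hφ.continuous_fderiv (by simp)
  obtain ⟨k1, hk1⟩ := (hφs.fderiv (𝕜 := ℝ)).exists_bound_of_continuous hfd
  have hs2 : HasCompactSupport fun x ↦ fderiv ℝ φ x x :=
    (hφs.fderiv (𝕜 := ℝ)).mono' fun x hx ↦ by
      refine subset_tsupport _ fun h ↦ hx ?_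
      simp only [h]; rfl
  obtain ⟨k2, hk2⟩ := hs2.exists_bound_of_continuous (hfd.clm_apply continuous_id)
  obtain ⟨k3, hk3⟩ := (hφs.iteratedFDeriv (𝕜 := ℝ) 2).exists_bound_of_continuous
    ((contDiff_infty.1 hφ 2).continuous_iteratedFDeriv le_rfl)
  refine ⟨|a| * |k2| + |k1| * |b| + c ^ 2 / 2 * (d * |k3|), by positivity, fun r hr x ↦ ?_⟩
  have e : S.generator r φ x = α r * fderiv ℝ φ x x + fderiv ℝ φ x (β r)
      + S.diffusion r ^ 2 / 2 * Laplacian.laplacian φ x := by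
    rw [SDE.generator, hdrift r hr, map_add, map_smul, smul_eq_mul]
  rw [e]
  have h1 : |α r * fderiv ℝ φ x x| ≤ |a| * |k2| := by
    rw [abs_mul]
    exact mul_le_mul ((ha r hr).trans (le_abs_self _)) ((hk2 x).trans (le_abs_self _))
      (abs_nonneg _) (abs_nonneg _)
  have h2 : |fderiv ℝ φ x (β r)| ≤ |k1| * |b| :=
    ((fderiv ℝ φ x).le_opNorm _).trans (mul_le_mul ((hk1 x).trans (le_abs_self _))
      ((hb r hr).trans (le_abs_self _)) (norm_nonneg _) (abs_nonneg _))
  have h3 : |S.diffusion r ^ 2 / 2 * Laplacian.laplacian φ x| ≤ c ^ 2 / 2 * (d * |k3|) := by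
    rw [abs_mul, abs_of_nonneg (by positivity : 0 ≤ S.diffusion r ^ 2 / 2)]
    have := hc r hr
    rw [Real.norm_eq_abs] at this
    have h4 : S.diffusion r ^ 2 ≤ c ^ 2 := sq_le_sq' (by linarith [neg_abs_le (S.diffusion r)])
      ((le_abs_self _).trans this)
    refine mul_le_mul (by linarith) ((abs_laplacian_le φ x).trans ?_) (abs_nonneg _) (by positivity)
    exact mul_le_mul_of_nonneg_left ((hk3 x).trans (le_abs_self _)) (Nat.cast_nonneg d)
  exact (abs_add_le _ _).trans (add_le_add ((abs_add_le _ _).trans (add_le_add h1 h2)) h3)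

lemma continuousOn_generator_comp {S : SDE d} {s t : ℝ} {α : ℝ → ℝ}
    {β : ℝ → EuclideanSpace ℝ (Fin d)} (hα : ContinuousOn α (Icc s t))
    (hβ : ContinuousOn β (Icc s t)) (hg : ContinuousOn S.diffusion (Icc s t))
    (hdrift : ∀ r ∈ Icc s t, ∀ x, S.drift r x = α r • x + β r)
    {φ : EuclideanSpace ℝ (Fin d) → ℝ} (hφ : ContDiff ℝ (⊤ : ℕ∞) φ)
    {x : ℝ → EuclideanSpace ℝ (Fin d)} (hx : ContinuousOn x (Icc s t)) :
    ContinuousOn (fun r ↦ S.generator r φ (x r)) (Icc s t) := by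
  have hfd : Continuous (fderiv ℝ φ) := hφ.continuous_fderiv (by simp)
  refine ContinuousOn.congr (f := fun r ↦ fderiv ℝ φ (x r) (α r • x r + β r)
      + S.diffusion r ^ 2 / 2 * Laplacian.laplacian φ (x r)) ?_ fun r hr ↦ by
    simp only [SDE.generator, hdrift r hr]
  exact ((hfd.comp_continuousOn hx).clm_apply ((hα.smul hx).add hβ)).add
    (((hg.pow 2).div_const 2).mul ((continuous_laplacian hφ).comp_continuousOn hx))

end MovingFrame

/-! ### Evolution of test functions along a weak solution with affine drift -/

section Evolution
variable {d : ℕ}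

/-- On `[s, t]` the drift of `S` is the affine map `x ↦ α_r x + β_r`, and the time-dependent
coordinate `y = l_r x + c_r` solves `l' = -α l`, `c' = -l β`, so that the drift vanishes in it. The
derivatives are right derivatives, for coefficients that are continuous on `[s, t]` only. -/
structure IsDriftlessFrame (S : SDE d) (s t : ℝ) (α : ℝ → ℝ) (β : ℝ → EuclideanSpace ℝ (Fin d))
    (l : ℝ → ℝ) (c : ℝ → EuclideanSpace ℝ (Fin d)) : Prop where
  drift_eq : ∀ r ∈ Icc s t, ∀ x, S.drift r x = α r • x + β r
  continuousOn_slope : ContinuousOn α (Icc s t)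
  continuousOn_offset : ContinuousOn β (Icc s t)
  continuousOn_diffusion : ContinuousOn S.diffusion (Icc s t)
  scale_pos : ∀ r ∈ Icc s t, 0 < l r
  continuousOn_scale : ContinuousOn l (Icc s t)
  continuousOn_shift : ContinuousOn c (Icc s t)
  hasDerivWithinAt_scale : ∀ r ∈ Ico s t, HasDerivWithinAt l (-(α r * l r)) (Ici r) r
  hasDerivWithinAt_shift : ∀ r ∈ Ico s t, HasDerivWithinAt c (-(l r • β r)) (Ici r) r

variable {S : SDE d} {I : Set ℝ} {Ω : Type} {mΩ : MeasurableSpace Ω}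
  {ℱ : Filtration ℝ mΩ} {P : Measure Ω} {X : ℝ → Ω → EuclideanSpace ℝ (Fin d)}
  {s t : ℝ} {α : ℝ → ℝ} {β : ℝ → EuclideanSpace ℝ (Fin d)}
  {l : ℝ → ℝ} {c : ℝ → EuclideanSpace ℝ (Fin d)}

lemma IsWeakSolution.measurable (hX : IsWeakSolution S I ℱ P X) {r : ℝ} (hr : r ∈ I) :
    Measurable (X r) := (hX.adapted r hr).mono (ℱ.le r) le_rfl

lemma IsWeakSolution.measurable_comp_affine (hX : IsWeakSolution S I ℱ P X) {r : ℝ} (hr : r ∈ I)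
    {u : EuclideanSpace ℝ (Fin d) → ℝ} (hu : Continuous u) (a : ℝ) (b : EuclideanSpace ℝ (Fin d)) :
    Measurable fun ω ↦ u (a • X r ω + b) :=
  (hu.comp (by fun_prop : Continuous fun x : EuclideanSpace ℝ (Fin d) ↦ a • x + b)).measurable.comp
    (hX.measurable hr)

lemma IsWeakSolution.continuousOn_setIntegral (hX : IsWeakSolution S I ℱ P X)
    (hI : Icc s t ⊆ I) (hl : ContinuousOn l (Icc s t)) (hc : ContinuousOn c (Icc s t)) (A : Set Ω)
    {u : EuclideanSpace ℝ (Fin d) → ℝ} (hu : Continuous u) {K : ℝ} (hK : ∀ y, |u y| ≤ K) :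
    ContinuousOn (fun r ↦ ∫ ω in A, u (l r • X r ω + c r) ∂P) (Icc s t) := by
  have := hX.isProbabilityMeasure
  refine continuousOn_of_dominated (bound := fun _ ↦ K) (fun r hr ↦ ?_)
    (fun r _ ↦ Eventually.of_forall fun ω ↦ hK _) (integrable_const _)
    (Eventually.of_forall fun ω ↦ ?_)
  · exact (hX.measurable_comp_affine (hI hr) hu _ _).aestronglyMeasurable
  · exact hu.comp_continuousOn ((hl.smul ((hX.continuousOn ω).mono hI)).add hc)

lemma IsDriftlessFrame.generator_comp (hF : IsDriftlessFrame S s t α β l c)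
    {Φ : EuclideanSpace ℝ (Fin d) → ℝ} (hΦ : ContDiff ℝ (⊤ : ℕ∞) Φ) {r : ℝ} (hr : r ∈ Icc s t)
    (x : EuclideanSpace ℝ (Fin d)) :
    S.generator r (fun z ↦ Φ (l r • z + c r)) x
      = fderiv ℝ Φ (l r • x + c r) ((α r * l r) • x + l r • β r)
        + l r ^ 2 * S.diffusion r ^ 2 / 2 * Laplacian.laplacian Φ (l r • x + c r) := by
  have hd : HasFDerivAt (fun z ↦ Φ (l r • z + c r))
      ((fderiv ℝ Φ (l r • x + c r)).comp
        (l r • ContinuousLinearMap.id ℝ (EuclideanSpace ℝ (Fin d)))) x :=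
    HasFDerivAt.comp x ((hΦ.differentiable (by simp)) _).hasFDerivAt
      (((hasFDerivAt_id x).const_smul (l r)).add_const (c r))
  rw [SDE.generator, laplacian_comp_homothety hΦ, hd.fderiv, hF.drift_eq r hr]
  congr 1
  · simp only [ContinuousLinearMap.comp_apply, smul_apply,
      ContinuousLinearMap.id_apply, smul_add, smul_smul, mul_comm (l r) (α r)]
  · ring

/-- The martingale problem integrated over an event of the past: Dynkin's formula. -/
lemma IsWeakSolution.setIntegral_sub_eq (hX : IsWeakSolution S I ℱ P X)
    {φ : EuclideanSpace ℝ (Fin d) → ℝ} (hφ : ContDiff ℝ (⊤ : ℕ∞) φ) (hφs : HasCompactSupport φ)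
    {r q : ℝ} (hr : r ∈ I) (hq : q ∈ I) (hrq : r ≤ q) {A : Set Ω} (hA : MeasurableSet[ℱ r] A) :
    Integrable (fun ω ↦ ∫ u in r..q, S.generator u φ (X u ω)) (P.restrict A) ∧
      ∫ ω in A, (φ (X q ω) - φ (X r ω)) ∂P =
        ∫ ω in A, (∫ u in r..q, S.generator u φ (X u ω)) ∂P := by
  have := hX.isProbabilityMeasure
  obtain ⟨M, hM⟩ := hφs.exists_bound_of_continuous hφ.continuous
  have hint : ∀ q ∈ I, Integrable (fun ω ↦ φ (X q ω)) (P.restrict A) :=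
    fun q hq ↦ Integrable.of_bound
      (hφ.continuous.measurable.comp (hX.measurable hq)).aestronglyMeasurable M
      (Eventually.of_forall fun ω ↦ hM _)
  have h1 := hX.integrable φ hφ hφs r hr q hq hrq
  have h2 := hX.condExp_eq_zero φ hφ hφs r hr q hq hrq
  have h3 := setIntegral_condExp (ℱ.le r) h1 hA
  rw [setIntegral_congr_ae (ℱ.le r A hA) (h2.mono fun _ h _ ↦ h)] at h3
  simp only [Pi.zero_apply, integral_zero] at h3
  have h4 : Integrable (fun ω ↦ φ (X q ω) - φ (X r ω)) (P.restrict A) :=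
    (hint q hq).sub (hint r hr)
  have h5 : Integrable (fun ω ↦ ∫ u in r..q, S.generator u φ (X u ω)) (P.restrict A) :=
    (h4.sub h1.restrict).congr (Eventually.of_forall fun ω ↦ by simp)
  refine ⟨h5, ?_⟩
  rw [integral_sub h4 h5] at h3
  linarith

/-- In a driftless frame the expectation of a test function of `l X + c` over an event of the past
evolves by the Laplacian alone. The test function depends on time, so its increment is split into
the motion of the frame at a fixed point and the motion of `X` in a fixed frame; the first-order
terms of the two cancel. -/
lemma IsWeakSolution.hasDerivWithinAt_setIntegral (hX : IsWeakSolution S I ℱ P X)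
    (hI : Icc s t ⊆ I) (hF : IsDriftlessFrame S s t α β l c)
    {Φ : EuclideanSpace ℝ (Fin d) → ℝ} (hΦ : ContDiff ℝ (⊤ : ℕ∞) Φ) (hΦs : HasCompactSupport Φ)
    {A : Set Ω} (hA : MeasurableSet[ℱ s] A) {r : ℝ} (hr : r ∈ Ico s t) :
    HasDerivWithinAt (fun q ↦ ∫ ω in A, Φ (l q • X q ω + c q) ∂P)
      (∫ ω in A, l r ^ 2 * S.diffusion r ^ 2 / 2 *
        Laplacian.laplacian Φ (l r • X r ω + c r) ∂P) (Ici r) r := by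
  have := hX.isProbabilityMeasure
  have hr' : r ∈ Icc s t := Ico_subset_Icc_self hr
  have hlr := hF.scale_pos r hr'
  have hAr : MeasurableSet[ℱ r] A := ℱ.mono hr.1 A hA
  have hAm : MeasurableSet A := ℱ.le s A hA
  set φ : EuclideanSpace ℝ (Fin d) → ℝ := fun z ↦ Φ (l r • z + c r) with hφdef
  have hφ : ContDiff ℝ (⊤ : ℕ∞) φ := hΦ.comp (by fun_prop)
  have hφs : HasCompactSupport φ := by
    let e : EuclideanSpace ℝ (Fin d) ≃ₜ EuclideanSpace ℝ (Fin d) :=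
      (Homeomorph.smulOfNeZero (l r) hlr.ne').trans (Homeomorph.addRight (c r))
    exact hΦs.comp_homeomorph e
  obtain ⟨K₁, hK₁⟩ := eventually_slope_moving_frame_le hΦ hΦs (hF.hasDerivWithinAt_scale r hr)
    (hF.hasDerivWithinAt_shift r hr) hlr
  obtain ⟨K₂, hK₂0, hK₂⟩ := exists_abs_generator_le hF.continuousOn_slope hF.continuousOn_offset
    hF.continuousOn_diffusion hF.drift_eq hφ hφs
  have hmem : ∀ᶠ q in 𝓝[>] r, q ∈ Ioc r t := Ioc_mem_nhdsGT hr.2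
  obtain ⟨M, hM⟩ := hΦs.exists_bound_of_continuous hΦ.continuous
  have hint : ∀ q ∈ Icc s t, ∀ a b, Integrable (fun ω ↦ Φ (a • X q ω + b)) (P.restrict A) :=
    fun q hq a b ↦ Integrable.of_bound
      (hX.measurable_comp_affine (hI hq) hΦ.continuous a b).aestronglyMeasurable M
      (Eventually.of_forall fun ω ↦ hM _)
  have hgenint : ∀ q ∈ Ioc r t,
      Integrable (fun ω ↦ ∫ u in r..q, S.generator u φ (X u ω)) (P.restrict A) ∧
      ∫ ω in A, (φ (X q ω) - φ (X r ω)) ∂P =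
        ∫ ω in A, (∫ u in r..q, S.generator u φ (X u ω)) ∂P :=
    fun q hq ↦ hX.setIntegral_sub_eq hφ hφs (hI hr') (hI ⟨hr.1.trans hq.1.le, hq.2⟩) hq.1.le hAr
  have hcont : ∀ ω, ContinuousOn (fun u ↦ S.generator u φ (X u ω)) (Icc s t) := fun ω ↦
    continuousOn_generator_comp hF.continuousOn_slope hF.continuousOn_offset
      hF.continuousOn_diffusion hF.drift_eq hφ ((hX.continuousOn ω).mono hI)
  rw [← hasDerivWithinAt_Ioi_iff_Ici, hasDerivWithinAt_iff_tendsto_slope' self_notMem_Ioi]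
  have hslope : ∀ᶠ q in 𝓝[>] r,
      ∫ ω in A, ((q - r)⁻¹ * (Φ (l q • X q ω + c q) - Φ (l r • X q ω + c r)) +
        (q - r)⁻¹ * ∫ u in r..q, S.generator u φ (X u ω)) ∂P =
      slope (fun q ↦ ∫ ω in A, Φ (l q • X q ω + c q) ∂P) r q := by
    filter_upwards [hmem] with q hq
    have hq' : q ∈ Icc s t := ⟨hr.1.trans hq.1.le, hq.2⟩
    have h1 := hint q hq' (l q) (c q)
    have h2 := hint q hq' (l r) (c r)
    have h3 := hint r hr' (l r) (c r)
    have h12 : Integrable (fun ω ↦ Φ (l q • X q ω + c q) - Φ (l r • X q ω + c r))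
      (P.restrict A) := h1.sub h2
    rw [integral_add (h12.const_mul _) ((hgenint q hq).1.const_mul _),
      integral_const_mul, integral_const_mul, ← (hgenint q hq).2, ← mul_add, slope_def_field,
      div_eq_inv_mul]
    congr 1
    simp only [hφdef]
    rw [integral_sub h1 h2, integral_sub h2 h3]
    ring
  refine Tendsto.congr' hslope ?_
  refine tendsto_integral_filter_of_dominated_convergence (fun _ ↦ K₁ + K₂) ?_ ?_
    (integrable_const _) (Eventually.of_forall fun ω ↦ ?_)
  · filter_upwards [hmem] with q hq
    have hq' : q ∈ Icc s t := ⟨hr.1.trans hq.1.le, hq.2⟩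
    exact ((((hint q hq' (l q) (c q)).sub (hint q hq' (l r) (c r))).const_mul _).add
      ((hgenint q hq).1.const_mul _)).aestronglyMeasurable
  · filter_upwards [hmem, hK₁] with q hq hKq
    refine Eventually.of_forall fun ω ↦ (norm_add_le _ _).trans (add_le_add (hKq _) ?_)
    have h1 : ‖∫ u in r..q, S.generator u φ (X u ω)‖ ≤ K₂ * |q - r| :=
      intervalIntegral.norm_integral_le_of_norm_le_const fun u hu ↦ by
        rw [uIoc_of_le hq.1.le] at hu
        exact hK₂ u ⟨hr.1.trans hu.1.le, hu.2.trans hq.2⟩ _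
    have h2 : 0 < q - r := sub_pos.2 hq.1
    rw [norm_mul, norm_inv, Real.norm_of_nonneg h2.le]
    rw [abs_of_pos h2] at h1
    rw [inv_mul_le_iff₀ h2]
    linarith
  · have hx : Tendsto (fun q ↦ X q ω) (𝓝[>] r) (𝓝 (X r ω)) := by
      have : ContinuousWithinAt (fun q ↦ X q ω) (Icc s t) r := ((hX.continuousOn ω).mono hI) r hr'
      exact this.mono_of_mem_nhdsWithin (s := Ioi r)
        (mem_of_superset (Icc_mem_nhdsGT hr.2) (Icc_subset_Icc_left hr.1))
    have h1 := tendsto_slope_moving_frame (x := fun q ↦ X q ω) hΦ (hF.hasDerivWithinAt_scale r hr)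
      (hF.hasDerivWithinAt_shift r hr) hx
    have h2 := (hasDerivWithinAt_primitive (hcont ω) hr' hr).tendsto_slope_right
    simp only [intervalIntegral.integral_same, sub_zero, smul_eq_mul] at h2
    have h3 := h1.add h2
    rw [hφdef, hF.generator_comp hΦ hr', ← add_assoc, ← map_add] at h3
    have e : (-(α r * l r)) • X r ω + -(l r • β r) + ((α r * l r) • X r ω + l r • β r) = 0 := by
      module
    rw [e, map_zero, zero_add] at h3
    exact h3

end Evolution

/-! ### Conditional laws of weak solutions with affine drift -/

lemma eq_mul_exp_of_integral_eq {m a : ℝ → ℝ} {s t κ : ℝ} (hst : s ≤ t)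
    (hm : ContinuousOn m (Icc s t)) (ha : ContinuousOn a (Icc s t))
    (h : ∀ q ∈ Icc s t, m q - m s = -κ * ∫ r in s..q, a r * m r) :
    m t = m s * Real.exp (-κ * ∫ r in s..t, a r) := by
  have hs : s ∈ Icc s t := left_mem_Icc.2 hst
  have ham : ContinuousOn (fun r ↦ a r * m r) (Icc s t) := ha.mul hm
  have hA : ContinuousOn (fun q ↦ ∫ r in s..q, a r) (Icc s t) := by
    have := intervalIntegral.continuousOn_primitive_interval
      (ha.integrableOn_compact isCompact_Icc (μ := volume) |>.mono_set (uIcc_of_le hst).le)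
    rwa [uIcc_of_le hst] at this
  have hE : ContinuousOn (fun q ↦ m q * Real.exp (κ * ∫ r in s..q, a r)) (Icc s t) :=
    hm.mul (Real.continuous_exp.comp_continuousOn (continuousOn_const.mul hA))
  have hder : ∀ q ∈ Ico s t, HasDerivWithinAt
      (fun q ↦ m q * Real.exp (κ * ∫ r in s..q, a r)) 0 (Ici q) q := by
    intro q hq
    have h1 := ((hasDerivWithinAt_primitive ham hs hq).const_mul (-κ)).const_add (m s)
    have h1' : HasDerivWithinAt m (-κ * (a q * m q)) (Icc q t) q := by
      refine (h1.mono Icc_subset_Ici_self).congr_of_mem (fun r hr ↦ ?_) (left_mem_Icc.2 hq.2.le)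
      rw [← h r ⟨hq.1.trans hr.1, hr.2⟩]; ring
    have h1'' : HasDerivWithinAt m (-κ * (a q * m q)) (Ici q) q :=
      h1'.mono_of_mem_nhdsWithin (Icc_mem_nhdsGE hq.2)
    have h2 := ((hasDerivWithinAt_primitive ha hs hq).const_mul κ).exp
    refine (h1''.mul h2).congr_deriv ?_
    ring
  have := constant_of_has_deriv_right_zero hE hder t (right_mem_Icc.2 hst)
  simp only [intervalIntegral.integral_same, mul_zero, Real.exp_zero, mul_one] at this
  rw [← this, mul_assoc, ← Real.exp_add]
  simp

section Evolution
variable {d : ℕ} {S : SDE d} {I : Set ℝ} {Ω : Type} {mΩ : MeasurableSpace Ω}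
  {ℱ : Filtration ℝ mΩ} {P : Measure Ω} {X : ℝ → Ω → EuclideanSpace ℝ (Fin d)}
  {s t : ℝ} {α : ℝ → ℝ} {β : ℝ → EuclideanSpace ℝ (Fin d)}
  {l : ℝ → ℝ} {c : ℝ → EuclideanSpace ℝ (Fin d)}

lemma IsWeakSolution.setIntegral_sub_eq_integral (hX : IsWeakSolution S I ℱ P X)
    (hI : Icc s t ⊆ I) (hF : IsDriftlessFrame S s t α β l c)
    {Φ : EuclideanSpace ℝ (Fin d) → ℝ} (hΦ : ContDiff ℝ (⊤ : ℕ∞) Φ) (hΦs : HasCompactSupport Φ)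
    {A : Set Ω} (hA : MeasurableSet[ℱ s] A) {q : ℝ} (hq : q ∈ Icc s t) :
    ∫ ω in A, Φ (l q • X q ω + c q) ∂P - ∫ ω in A, Φ (l s • X s ω + c s) ∂P =
      ∫ r in s..q, l r ^ 2 * S.diffusion r ^ 2 / 2 *
        ∫ ω in A, Laplacian.laplacian Φ (l r • X r ω + c r) ∂P := by
  obtain ⟨M, hM⟩ := hΦs.exists_bound_of_continuous hΦ.continuous
  obtain ⟨K, hK⟩ := (hΦs.iteratedFDeriv (𝕜 := ℝ) 2).exists_bound_of_continuous
    ((contDiff_infty.1 hΦ 2).continuous_iteratedFDeriv le_rfl)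
  have hsub : Icc s q ⊆ Icc s t := Icc_subset_Icc_right hq.2
  have h1 := (hX.continuousOn_setIntegral hI hF.continuousOn_scale hF.continuousOn_shift A
    hΦ.continuous hM).mono hsub
  have h2 := (hX.continuousOn_setIntegral hI hF.continuousOn_scale hF.continuousOn_shift A
    (continuous_laplacian hΦ) (K := d * K) (fun y ↦ (abs_laplacian_le Φ y).trans
      (mul_le_mul_of_nonneg_left (hK y) (Nat.cast_nonneg d)))).mono hsub
  have h3 : ContinuousOn (fun r ↦ l r ^ 2 * S.diffusion r ^ 2 / 2) (Icc s q) :=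
    (((hF.continuousOn_scale.pow 2).mul (hF.continuousOn_diffusion.pow 2)).div_const 2).mono hsub
  refine (integral_eq_sub_of_hasDerivWithinAt_Ici hq.1 h1 (h3.mul h2) fun r hr ↦ ?_).symm
  have := hX.hasDerivWithinAt_setIntegral hI hF hΦ hΦs hA (Ico_subset_Ico_right hq.2 hr)
  rwa [integral_const_mul] at this

/-- The expectation of a bounded eigenfunction of the Laplacian decays exponentially. The
eigenfunction is not compactly supported; the formula passes to the limit along truncations because
the generator has no first-order term in a driftless frame, hence stays bounded. -/
lemma IsWeakSolution.setIntegral_eigenfunction (hX : IsWeakSolution S I ℱ P X)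
    (hI : Icc s t ⊆ I) (hst : s ≤ t) (hF : IsDriftlessFrame S s t α β l c)
    {u : EuclideanSpace ℝ (Fin d) → ℝ} (hu : ContDiff ℝ (⊤ : ℕ∞) u) {C κ : ℝ}
    (hC : ∀ i ≤ 2, ∀ y, ‖iteratedFDeriv ℝ i u y‖ ≤ C)
    (hκ : ∀ y, Laplacian.laplacian u y = -κ * u y)
    {A : Set Ω} (hA : MeasurableSet[ℱ s] A) :
    ∫ ω in A, u (l t • X t ω + c t) ∂P = (∫ ω in A, u (l s • X s ω + c s) ∂P) *
      Real.exp (-(κ / 2) * ∫ r in s..t, l r ^ 2 * S.diffusion r ^ 2) := by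
  have := hX.isProbabilityMeasure
  obtain ⟨Φ, hΦ, hΦs, ⟨K, hK⟩, hlim⟩ := exists_compactSupport_approx hu hC
  have hub : ∀ y, |u y| ≤ C := fun y ↦ by
    have := hC 0 (by norm_num) y
    rwa [norm_iteratedFDeriv_zero] at this
  have hm := hX.continuousOn_setIntegral hI hF.continuousOn_scale hF.continuousOn_shift A
    hu.continuous hub
  have ha : ContinuousOn (fun r ↦ l r ^ 2 * S.diffusion r ^ 2) (Icc s t) :=
    (hF.continuousOn_scale.pow 2).mul (hF.continuousOn_diffusion.pow 2)
  refine eq_mul_exp_of_integral_eq (m := fun r ↦ ∫ ω in A, u (l r • X r ω + c r) ∂P) hst hm ha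
    fun q hq ↦ ?_
  have hsub : Icc s q ⊆ Icc s t := Icc_subset_Icc_right hq.2
  have hs : s ∈ Icc s t := left_mem_Icc.2 hst
  -- convergence of the integrals of the truncated functions and of their Laplacians
  have hconv : ∀ r ∈ Icc s t, Tendsto (fun n ↦ ∫ ω in A, Φ n (l r • X r ω + c r) ∂P) atTop
      (𝓝 (∫ ω in A, u (l r • X r ω + c r) ∂P)) := fun r hr ↦
    tendsto_integral_of_dominated_convergence (fun _ ↦ K)
      (fun n ↦ (hX.measurable_comp_affine (hI hr) (hΦ n).continuous _ _).aestronglyMeasurable)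
      (integrable_const _) (fun n ↦ Eventually.of_forall fun ω ↦ (hK n _).1)
      (Eventually.of_forall fun ω ↦
        tendsto_const_nhds.congr' ((hlim _).mono fun n hn ↦ hn.1.symm))
  have hconv2 : ∀ r ∈ Icc s t, Tendsto
      (fun n ↦ ∫ ω in A, Laplacian.laplacian (Φ n) (l r • X r ω + c r) ∂P) atTop
      (𝓝 (-κ * ∫ ω in A, u (l r • X r ω + c r) ∂P)) := fun r hr ↦ by
    rw [← integral_const_mul]
    refine tendsto_integral_of_dominated_convergence (fun _ ↦ K)
      (fun n ↦ (hX.measurable_comp_affine (hI hr)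
        (continuous_laplacian (hΦ n)) _ _).aestronglyMeasurable)
      (integrable_const _) (fun n ↦ Eventually.of_forall fun ω ↦ (hK n _).2)
      (Eventually.of_forall fun ω ↦ ?_)
    rw [← hκ]
    exact tendsto_const_nhds.congr' ((hlim _).mono fun n hn ↦ hn.2.symm)
  have hR : Tendsto (fun n ↦ ∫ r in s..q, l r ^ 2 * S.diffusion r ^ 2 / 2 *
        ∫ ω in A, Laplacian.laplacian (Φ n) (l r • X r ω + c r) ∂P) atTop
      (𝓝 (∫ r in s..q, l r ^ 2 * S.diffusion r ^ 2 / 2 *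
        (-κ * ∫ ω in A, u (l r • X r ω + c r) ∂P))) := by
    have hK0 : 0 ≤ K := (abs_nonneg _).trans (hK 0 0).1
    refine intervalIntegral.tendsto_integral_filter_of_dominated_convergence
      (fun r ↦ l r ^ 2 * S.diffusion r ^ 2 / 2 * K) ?_ ?_ ?_ ?_
    · refine Eventually.of_forall fun n ↦ ContinuousOn.aestronglyMeasurable ?_ measurableSet_uIoc
      rw [uIoc_of_le hq.1]
      exact ((ha.div_const 2).mul (hX.continuousOn_setIntegral hI hF.continuousOn_scale
        hF.continuousOn_shift A (continuous_laplacian (hΦ n)) fun y ↦ (hK n y).2)).mono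
        (Ioc_subset_Icc_self.trans hsub)
    · refine Eventually.of_forall fun n ↦ Eventually.of_forall fun r _ ↦ ?_
      rw [norm_mul, Real.norm_of_nonneg (by positivity)]
      refine mul_le_mul_of_nonneg_left ?_ (by positivity)
      refine (norm_setIntegral_le_of_norm_le_const (measure_lt_top P A)
        (fun ω _ ↦ (hK n _).2)).trans ?_
      exact mul_le_of_le_one_right hK0 measureReal_le_one
    · exact (((ha.div_const 2).mul continuousOn_const).mono hsub).intervalIntegrable_of_Icc hq.1
    · refine Eventually.of_forall fun r hr ↦ ?_
      rw [uIoc_of_le hq.1] at hr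
      exact (hconv2 r (hsub ⟨hr.1.le, hr.2⟩)).const_mul _
  have hL := (hconv q hq).sub (hconv s hs)
  have heq := tendsto_nhds_unique (hL.congr fun n ↦
    hX.setIntegral_sub_eq_integral hI hF (hΦ n) (hΦs n) hA hq) hR
  rw [heq, ← intervalIntegral.integral_const_mul]
  refine intervalIntegral.integral_congr fun r _ ↦ ?_
  ring

lemma norm_iteratedFDeriv_comp_inner_le {w : ℝ → ℝ} (hw : ContDiff ℝ (⊤ : ℕ∞) w)
    (hb : ∀ n x, ‖iteratedDeriv n w x‖ ≤ 1) (ξ y : EuclideanSpace ℝ (Fin d)) (i : ℕ) (hi : i ≤ 2) :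
    ‖iteratedFDeriv ℝ i (fun z ↦ w (inner ℝ z ξ)) y‖ ≤ (1 + ‖ξ‖) ^ 2 := by
  rw [iteratedFDeriv_comp_inner hw]
  refine (ContinuousMultilinearMap.norm_compContinuousLinearMap_le _ _).trans ?_
  rw [norm_iteratedFDeriv_eq_norm_iteratedDeriv]
  simp only [innerSL_apply_norm, Finset.prod_const, Finset.card_univ, Fintype.card_fin]
  calc _ ≤ 1 * (1 + ‖ξ‖) ^ i := by
        gcongr
        · exact hb i _
        · linarith
    _ ≤ _ := by
        rw [one_mul]
        exact pow_le_pow_right₀ (by linarith [norm_nonneg ξ]) hi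

/-- Conditionally on `ℱ s`, the increment of the driftless coordinate is `N(0, v I)` with
`v = ∫ l² g²`, in terms of characteristic functions. -/
lemma IsWeakSolution.charFun_map_restrict (hX : IsWeakSolution S I ℱ P X)
    (hI : Icc s t ⊆ I) (hst : s ≤ t) (hF : IsDriftlessFrame S s t α β l c)
    {A : Set Ω} (hA : MeasurableSet[ℱ s] A) (ξ : EuclideanSpace ℝ (Fin d)) :
    charFun ((P.restrict A).map fun ω ↦ l t • X t ω + c t) ξ =
      charFun ((P.restrict A).map fun ω ↦ l s • X s ω + c s) ξ *
        Complex.exp (-((∫ r in s..t, l r ^ 2 * S.diffusion r ^ 2) * ‖ξ‖ ^ 2 / 2 : ℝ)) := by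
  have := hX.isProbabilityMeasure
  have key : ∀ w : ℝ → ℝ, ContDiff ℝ (⊤ : ℕ∞) w → (∀ n x, ‖iteratedDeriv n w x‖ ≤ 1) →
      (∀ x, iteratedDeriv 2 w x = -w x) →
      ∫ ω in A, w (inner ℝ (l t • X t ω + c t) ξ) ∂P =
        (∫ ω in A, w (inner ℝ (l s • X s ω + c s) ξ) ∂P) *
        Real.exp (-((∫ r in s..t, l r ^ 2 * S.diffusion r ^ 2) * ‖ξ‖ ^ 2 / 2)) := by
    intro w hw hb h2
    have := hX.setIntegral_eigenfunction hI hst hF (u := fun z ↦ w (inner ℝ z ξ))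
      (hw.comp (contDiff_id.inner ℝ contDiff_const)) (κ := ‖ξ‖ ^ 2)
      (fun i hi y ↦ norm_iteratedFDeriv_comp_inner_le hw hb ξ y i hi)
      (fun y ↦ by rw [laplacian_comp_inner hw, h2]; ring) hA
    rw [this]
    congr 2
    ring
  have hcos := key Real.cos Real.contDiff_cos (fun n x ↦ Real.abs_iteratedDeriv_cos_le_one n x)
    (fun x ↦ by simp [iteratedDeriv_succ])
  have hsin := key Real.sin Real.contDiff_sin (fun n x ↦ Real.abs_iteratedDeriv_sin_le_one n x)
    (fun x ↦ by simp [iteratedDeriv_succ])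
  have hmeas : ∀ r ∈ Icc s t, Measurable fun ω ↦ l r • X r ω + c r := fun r hr ↦
    (by fun_prop : Continuous fun x : EuclideanSpace ℝ (Fin d) ↦ l r • x + c r).measurable.comp
      (hX.measurable (hI hr))
  have hexp : ∀ r ∈ Icc s t, charFun ((P.restrict A).map fun ω ↦ l r • X r ω + c r) ξ =
      ((∫ ω in A, Real.cos (inner ℝ (l r • X r ω + c r) ξ) ∂P : ℝ) : ℂ) +
      ((∫ ω in A, Real.sin (inner ℝ (l r • X r ω + c r) ξ) ∂P : ℝ) : ℂ) * Complex.I := by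
    intro r hr
    rw [charFun_apply, integral_map (hmeas r hr).aemeasurable
      (by fun_prop : Continuous fun x : EuclideanSpace ℝ (Fin d) ↦
        Complex.exp (inner ℝ x ξ * Complex.I)).aestronglyMeasurable,
      ← integral_complex_ofReal, ← integral_complex_ofReal, ← integral_mul_const, ← integral_add]
    · refine integral_congr_ae (Eventually.of_forall fun ω ↦ ?_)
      simp only [Complex.exp_mul_I, Complex.ofReal_cos, Complex.ofReal_sin]
    · refine Integrable.of_bound (C := 1) ?_ (Eventually.of_forall fun ω ↦ ?_)
      · exact (Complex.measurable_ofReal.comp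
          (Real.measurable_cos.comp ((hmeas r hr).inner_const))).aestronglyMeasurable
      · rw [Complex.norm_real]; exact Real.abs_cos_le_one _
    · refine Integrable.mul_const (Integrable.of_bound (C := 1) ?_
        (Eventually.of_forall fun ω ↦ ?_)) _
      · exact (Complex.measurable_ofReal.comp
          (Real.measurable_sin.comp ((hmeas r hr).inner_const))).aestronglyMeasurable
      · rw [Complex.norm_real]; exact Real.abs_sin_le_one _
  rw [hexp t (right_mem_Icc.2 hst), hexp s (left_mem_Icc.2 hst), hcos, hsin,
    ← Complex.ofReal_neg, ← Complex.ofReal_exp]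
  push_cast
  ring

/-- Conditionally on `ℱ s`, the law of `X t` is `N(M (X s), v I)`. -/
lemma IsWeakSolution.restrict_apply_preimage (hX : IsWeakSolution S I ℱ P X)
    (hI : Icc s t ⊆ I) (hst : s ≤ t) (hF : IsDriftlessFrame S s t α β l c)
    {v : ℝ} (hv : 0 < v) (hvl : l t ^ 2 * v = ∫ r in s..t, l r ^ 2 * S.diffusion r ^ 2)
    {M : EuclideanSpace ℝ (Fin d) → EuclideanSpace ℝ (Fin d)} (hM : Continuous M)
    (hMl : ∀ x, l t • M x + c t = l s • x + c s)
    {A : Set Ω} (hA : MeasurableSet[ℱ s] A) {B : Set (EuclideanSpace ℝ (Fin d))}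
    (hB : MeasurableSet B) :
    P.restrict A (X t ⁻¹' B) =
      ∫⁻ ω in A, (∫⁻ y in B, ENNReal.ofReal (isoGaussianPDF v (M (X s ω)) y)) ∂P := by
  have := hX.isProbabilityMeasure
  have hlt := hF.scale_pos t (right_mem_Icc.2 hst)
  have hXt := hX.measurable (hI (right_mem_Icc.2 hst))
  have hXs := hX.measurable (hI (left_mem_Icc.2 hst))
  refine map_apply_of_charFun_eq hv hXt (hM.measurable.comp hXs) (fun ξ ↦ ?_) hB
  have h := hX.charFun_map_restrict hI hst hF hA ((l t)⁻¹ • ξ)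
  have hmul : ∀ Z : Ω → EuclideanSpace ℝ (Fin d), Measurable Z →
      charFun ((P.restrict A).map fun ω ↦ l t • Z ω + c t) ((l t)⁻¹ • ξ) =
      charFun ((P.restrict A).map Z) ξ * Complex.exp (inner ℝ (c t) ((l t)⁻¹ • ξ) * Complex.I) := by
    intro Z hZ
    have haff : Measurable fun ω ↦ l t • Z ω + c t :=
      (by fun_prop : Continuous fun x : EuclideanSpace ℝ (Fin d) ↦ l t • x + c t).measurable.comp hZ
    rw [charFun_apply, charFun_apply, integral_map haff.aemeasurable (by fun_prop),
      integral_map hZ.aemeasurable (by fun_prop), ← integral_mul_const]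
    refine integral_congr_ae (Eventually.of_forall fun ω ↦ ?_)
    simp only
    rw [← Complex.exp_add, inner_add_left, real_inner_smul_left, real_inner_smul_right,
      mul_inv_cancel_left₀ hlt.ne']
    push_cast
    ring_nf
  simp only [← hMl] at h
  rw [hmul _ hXt, hmul (fun ω ↦ M (X s ω)) (hM.measurable.comp hXs), mul_right_comm] at h
  have h2 := mul_right_cancel₀ (Complex.exp_ne_zero _) h
  rw [h2, ← hvl, norm_smul, norm_inv, Real.norm_of_nonneg hlt.le]
  congr 4
  field_simp

end Evolution

/-! ### The integrating factor and the coefficients on `[0, T]` -/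

lemma continuousOn_primitive_Icc {F : Type*} [NormedAddCommGroup F] [NormedSpace ℝ F]
    {φ : ℝ → F} {a b : ℝ} (hab : a ≤ b) (hφ : ContinuousOn φ (Icc a b)) :
    ContinuousOn (fun q ↦ ∫ u in a..q, φ u) (Icc a b) := by
  have := intervalIntegral.continuousOn_primitive_interval
    (hφ.integrableOn_compact isCompact_Icc (μ := volume) |>.mono_set (uIcc_of_le hab).le)
  rwa [uIcc_of_le hab] at this

lemma gradient_log_isoGaussianPDF {d : ℕ} {v : ℝ} (hv : 0 < v) (a : ℝ)
    (b y x : EuclideanSpace ℝ (Fin d)) :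
    gradient (fun z ↦ Real.log (isoGaussianPDF v (a • z + b) y)) x
      = (a / v) • (y - (a • x + b)) := by
  have h1 : (fun z ↦ Real.log (isoGaussianPDF v (a • z + b) y)) = fun z ↦
      Real.log ((2 * Real.pi * v) ^ (-(d : ℝ) / 2)) + (-(2 * v)⁻¹) * ‖y - (a • z + b)‖ ^ 2 := by
    ext z
    rw [isoGaussianPDF, Real.log_mul (by positivity) (Real.exp_pos _).ne', Real.log_exp]
    ring
  rw [h1]
  refine HasGradientAt.gradient ?_
  rw [hasGradientAt_iff_hasFDerivAt]
  have h2 : HasFDerivAt (fun z : EuclideanSpace ℝ (Fin d) ↦ y - (a • z + b))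
      (-(a • ContinuousLinearMap.id ℝ (EuclideanSpace ℝ (Fin d)))) x :=
    ((((hasFDerivAt_id x).const_smul a).add_const b).const_sub y)
  refine ((h2.norm_sq.const_mul (-(2 * v)⁻¹)).const_add _).congr_fderiv ?_
  ext z
  simp only [InnerProductSpace.toDual_apply_apply, smul_apply,
    ContinuousLinearMap.comp_apply, neg_apply, ContinuousLinearMap.id_apply,
    innerSL_apply_apply, smul_eq_mul, inner_neg_right, real_inner_smul_right, real_inner_smul_left,
    nsmul_eq_mul, Nat.cast_ofNat]
  field_simp

section Coefficients
variable {d : ℕ} (D : LinearData d)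

/-- The continuity and nondegeneracy assumptions on the coefficients. -/
structure LinearData.IsRegular : Prop where
  pos : 0 < D.T
  continuousOn_f : ContinuousOn D.f (Icc 0 D.T)
  continuousOn_h : ContinuousOn D.h (Icc 0 D.T)
  continuousOn_g : ContinuousOn D.g (Icc 0 D.T)
  exists_ne_zero : ∀ s t, 0 ≤ s → s < t → t ≤ D.T → ∃ r ∈ Ioo s t, D.g r ≠ 0

/-- The integrating factor `exp (-∫_0^t f)`. -/
noncomputable def LinearData.damping (t : ℝ) : ℝ := Real.exp (-D.fBar 0 t)

/-- The coordinate `y = exp (-∫_0^t f) x - h̄_{0:t} m` in which the uncontrolled equation has no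
drift. -/
noncomputable def LinearData.straighten (t : ℝ) (x : EuclideanSpace ℝ (Fin d)) :
    EuclideanSpace ℝ (Fin d) := D.damping t • x - D.hBar 0 t • D.m

variable {D}

lemma LinearData.damping_pos (t : ℝ) : 0 < D.damping t := Real.exp_pos _

@[simp] lemma LinearData.damping_zero : D.damping 0 = 1 := by simp [damping, fBar]

@[simp] lemma LinearData.straighten_zero (x : EuclideanSpace ℝ (Fin d)) :
    D.straighten 0 x = x := by simp [straighten, hBar]

lemma LinearData.exp_fBar (t : ℝ) : Real.exp (D.fBar 0 t) = (D.damping t)⁻¹ := by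
  rw [damping, Real.exp_neg, inv_inv]

namespace LinearData.IsRegular

lemma hasDerivWithinAt_damping (hD : D.IsRegular) {r : ℝ} (hr : r ∈ Ico 0 D.T) :
    HasDerivWithinAt D.damping (-(D.f r * D.damping r)) (Ici r) r := by
  have h := (hasDerivWithinAt_primitive hD.continuousOn_f (left_mem_Icc.2 hD.pos.le) hr).neg.exp
  refine h.congr_deriv ?_
  simp only [damping, fBar, Pi.neg_apply]
  ring

lemma continuousOn_damping (hD : D.IsRegular) : ContinuousOn D.damping (Icc 0 D.T) :=
  Real.continuous_exp.comp_continuousOn (continuousOn_primitive_Icc hD.pos.le hD.continuousOn_f).neg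

lemma continuousOn_damping_mul_h (hD : D.IsRegular) :
    ContinuousOn (fun z ↦ D.damping z * D.h z) (Icc 0 D.T) :=
  hD.continuousOn_damping.mul hD.continuousOn_h

lemma continuousOn_damping_mul_g (hD : D.IsRegular) :
    ContinuousOn (fun z ↦ D.damping z * D.g z) (Icc 0 D.T) :=
  hD.continuousOn_damping.mul hD.continuousOn_g

lemma _root_.LinearData.g2Bar_eq (s t : ℝ) :
    D.g2Bar s t = ∫ z in s..t, (D.damping z * D.g z) ^ 2 := by
  unfold g2Bar
  refine intervalIntegral.integral_congr fun z _ ↦ ?_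
  simp only [damping, mul_pow, ← Real.exp_nat_mul]
  congr 2
  push_cast; ring

lemma _root_.LinearData.intervalIntegrable {φ : ℝ → ℝ} (hφ : ContinuousOn φ (Icc 0 D.T)) {s t : ℝ}
    (hs : s ∈ Icc 0 D.T) (ht : t ∈ Icc 0 D.T) : IntervalIntegrable φ volume s t :=
  (hφ.mono (uIcc_subset_Icc hs ht)).intervalIntegrable

lemma zero_mem (hD : D.IsRegular) : (0 : ℝ) ∈ Icc 0 D.T := left_mem_Icc.2 hD.pos.le

lemma T_mem (hD : D.IsRegular) : D.T ∈ Icc 0 D.T := right_mem_Icc.2 hD.pos.le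

lemma fBar_eq_sub (hD : D.IsRegular) {s t : ℝ} (hs : s ∈ Icc 0 D.T) (ht : t ∈ Icc 0 D.T) :
    D.fBar s t = D.fBar 0 t - D.fBar 0 s :=
  (intervalIntegral.integral_interval_sub_left (intervalIntegrable hD.continuousOn_f hD.zero_mem ht)
    (intervalIntegrable hD.continuousOn_f hD.zero_mem hs)).symm

lemma hBar_eq_sub (hD : D.IsRegular) {s t : ℝ} (hs : s ∈ Icc 0 D.T) (ht : t ∈ Icc 0 D.T) :
    D.hBar s t = D.hBar 0 t - D.hBar 0 s :=
  (intervalIntegral.integral_interval_sub_left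
    (intervalIntegrable hD.continuousOn_damping_mul_h hD.zero_mem ht)
    (intervalIntegrable hD.continuousOn_damping_mul_h hD.zero_mem hs)).symm

lemma g2Bar_add (hD : D.IsRegular) {s r t : ℝ} (hs : s ∈ Icc 0 D.T) (hr : r ∈ Icc 0 D.T)
    (ht : t ∈ Icc 0 D.T) :
    D.g2Bar s r + D.g2Bar r t = D.g2Bar s t := by
  have h := hD.continuousOn_damping_mul_g.pow 2
  simp only [g2Bar_eq]
  exact intervalIntegral.integral_add_adjacent_intervals (intervalIntegrable h hs hr)
    (intervalIntegrable h hr ht)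

lemma g2Bar_pos (hD : D.IsRegular) {s t : ℝ} (hs : 0 ≤ s) (hst : s < t) (ht : t ≤ D.T) :
    0 < D.g2Bar s t := by
  obtain ⟨r, hr, hgr⟩ := hD.exists_ne_zero s t hs hst ht
  rw [g2Bar_eq]
  refine intervalIntegral.integral_pos hst
    ((hD.continuousOn_damping_mul_g.pow 2).mono (Icc_subset_Icc hs ht))
    (fun z _ ↦ by positivity) ⟨r, Ioo_subset_Icc_self hr, ?_⟩
  have := (damping_pos (D := D) r).ne'
  positivity

lemma _root_.LinearData.condVar_eq {s t : ℝ} :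
    D.condVar s t = (D.damping t)⁻¹ ^ 2 * D.g2Bar s t := by
  rw [condVar, ← exp_fBar, ← Real.exp_nat_mul]; push_cast; rfl

lemma condVar_pos (hD : D.IsRegular) {s t : ℝ} (hs : 0 ≤ s) (hst : s < t) (ht : t ≤ D.T) :
    0 < D.condVar s t := by
  rw [condVar_eq]
  have := D.damping_pos t
  have := hD.g2Bar_pos hs hst ht
  positivity

lemma exp_fBar_eq (hD : D.IsRegular) {s t : ℝ} (hs : s ∈ Icc 0 D.T) (ht : t ∈ Icc 0 D.T) :
    Real.exp (D.fBar s t) = (D.damping t)⁻¹ * D.damping s := by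
  rw [hD.fBar_eq_sub hs ht, sub_eq_add_neg, Real.exp_add, exp_fBar]; rfl

lemma straighten_sub_straighten (hD : D.IsRegular) {s t : ℝ} (hs : s ∈ Icc 0 D.T)
    (ht : t ∈ Icc 0 D.T)
    (x y : EuclideanSpace ℝ (Fin d)) :
    y - D.condMean s x t = (D.damping t)⁻¹ • (D.straighten t y - D.straighten s x) := by
  have := (D.damping_pos t).ne'
  rw [condMean, hD.exp_fBar_eq hs ht, exp_fBar, hD.hBar_eq_sub hs ht, straighten, straighten]
  simp only [smul_sub, smul_smul, inv_mul_cancel₀ this, one_smul, mul_sub, sub_smul]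
  abel

lemma hasDerivWithinAt_hBar (hD : D.IsRegular) {r : ℝ} (hr : r ∈ Ico 0 D.T) :
    HasDerivWithinAt (fun t ↦ D.hBar 0 t) (D.damping r * D.h r) (Ici r) r :=
  hasDerivWithinAt_primitive hD.continuousOn_damping_mul_h hD.zero_mem hr

lemma continuousOn_hBar (hD : D.IsRegular) : ContinuousOn (fun t ↦ D.hBar 0 t) (Icc 0 D.T) :=
  continuousOn_primitive_Icc hD.pos.le hD.continuousOn_damping_mul_h

lemma hasDerivWithinAt_g2Bar (hD : D.IsRegular) {r : ℝ} (hr : r ∈ Ico 0 D.T) :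
    HasDerivWithinAt (fun t ↦ D.g2Bar t D.T) (-(D.damping r * D.g r) ^ 2) (Ici r) r := by
  have h := ((hasDerivWithinAt_primitive (hD.continuousOn_damping_mul_g.pow 2)
    hD.zero_mem hr).const_sub (D.g2Bar 0 D.T))
  have h2 : HasDerivWithinAt (fun t ↦ D.g2Bar t D.T)
      (-(D.damping r * D.g r) ^ 2) (Icc r D.T) r := by
    refine (h.mono Icc_subset_Ici_self).congr_of_mem (fun t ht ↦ ?_) (left_mem_Icc.2 hr.2.le)
    rw [← hD.g2Bar_add hD.zero_mem ⟨hr.1.trans ht.1, ht.2⟩ hD.T_mem, g2Bar_eq 0 t]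
    simp
  exact h2.mono_of_mem_nhdsWithin (Icc_mem_nhdsGE hr.2)

lemma continuousOn_g2Bar (hD : D.IsRegular) : ContinuousOn (fun t ↦ D.g2Bar t D.T) (Icc 0 D.T) := by
  have h := (continuousOn_const (c := D.g2Bar 0 D.T)).sub
    (continuousOn_primitive_Icc hD.pos.le (hD.continuousOn_damping_mul_g.pow 2))
  refine h.congr fun t ht ↦ ?_
  rw [← hD.g2Bar_add hD.zero_mem ht hD.T_mem, g2Bar_eq 0 t]
  simp

/-- The frame of the uncontrolled equation is `straighten`. -/
lemma isDriftlessFrame_sde (hD : D.IsRegular) {s t : ℝ} (hs : 0 ≤ s) (ht : t ≤ D.T) :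
    IsDriftlessFrame D.sde s t D.f (fun r ↦ D.h r • D.m) D.damping
      (fun r ↦ -(D.hBar 0 r • D.m)) where
  drift_eq r _ x := rfl
  continuousOn_slope := hD.continuousOn_f.mono (Icc_subset_Icc hs ht)
  continuousOn_offset := (hD.continuousOn_h.mono (Icc_subset_Icc hs ht)).smul continuousOn_const
  continuousOn_diffusion := hD.continuousOn_g.mono (Icc_subset_Icc hs ht)
  scale_pos r _ := D.damping_pos r
  continuousOn_scale := hD.continuousOn_damping.mono (Icc_subset_Icc hs ht)
  continuousOn_shift :=
    ((hD.continuousOn_hBar.mono (Icc_subset_Icc hs ht)).smul continuousOn_const).neg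
  hasDerivWithinAt_scale r hr := hD.hasDerivWithinAt_damping ⟨hs.trans hr.1, hr.2.trans_le ht⟩
  hasDerivWithinAt_shift r hr := by
    have := ((hD.hasDerivWithinAt_hBar ⟨hs.trans hr.1, hr.2.trans_le ht⟩).smul_const D.m).neg
    refine this.congr_deriv ?_
    rw [smul_smul]

/-- The score of the transition density points from the state towards the target in the driftless
coordinate. -/
lemma gradient_log_gaussianDensity (hD : D.IsRegular) {t : ℝ} (ht : t ∈ Ico 0 D.T)
    (x xT : EuclideanSpace ℝ (Fin d)) :
    gradient (fun z ↦ Real.log (D.gaussianDensity t z D.T xT)) x =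
      (D.damping t / D.g2Bar t D.T) • (D.straighten D.T xT - D.straighten t x) := by
  have ht' := Ico_subset_Icc_self ht
  have hv := hD.condVar_pos ht.1 ht.2 le_rfl
  have h := gradient_log_isoGaussianPDF hv (Real.exp (D.fBar t D.T))
    ((Real.exp (D.fBar 0 D.T) * D.hBar t D.T) • D.m) xT x
  have hG := (hD.g2Bar_pos ht.1 ht.2 le_rfl).ne'
  have he := (D.damping_pos D.T).ne'
  refine h.trans ?_
  rw [← condMean, hD.straighten_sub_straighten ht' hD.T_mem, smul_smul, condVar_eq,
    hD.exp_fBar_eq ht' hD.T_mem]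
  congr 1
  field_simp

end LinearData.IsRegular
end Coefficients

/-! ### The transition density and the bridge -/

section TransitionDensity
variable {d : ℕ} {D : LinearData d}

lemma lintegral_isoGaussianPDF_eq_ofReal {v : ℝ} (hv : 0 < v) (μ : EuclideanSpace ℝ (Fin d))
    (B : Set (EuclideanSpace ℝ (Fin d))) :
    ∫⁻ y in B, ENNReal.ofReal (isoGaussianPDF v μ y)
      = ENNReal.ofReal (∫ y in B, isoGaussianPDF v μ y) :=
  (ofReal_integral_eq_lintegral_ofReal (integrable_isoGaussianPDF hv μ).restrict
    (Eventually.of_forall fun y ↦ (isoGaussianPDF_pos hv μ y).le)).symm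

lemma stronglyMeasurable_setIntegral_isoGaussianPDF (v : ℝ) (B : Set (EuclideanSpace ℝ (Fin d))) :
    StronglyMeasurable fun μ : EuclideanSpace ℝ (Fin d) ↦ ∫ y in B, isoGaussianPDF v μ y :=
  (continuous_fst.isoGaussianPDF continuous_snd).stronglyMeasurable.integral_prod_right'

lemma continuous_condMean (s t : ℝ) : Continuous fun x ↦ D.condMean s x t := by
  unfold LinearData.condMean; fun_prop

lemma LinearData.IsRegular.setIntegral_condMean_integrable (hD : D.IsRegular) {s t : ℝ}
    (hs : 0 ≤ s) (hst : s < t) (ht : t ≤ D.T) {Ω : Type} {mΩ : MeasurableSpace Ω} {P : Measure Ω}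
    [IsFiniteMeasure P] {X : Ω → EuclideanSpace ℝ (Fin d)} (hX : Measurable X)
    (B : Set (EuclideanSpace ℝ (Fin d))) :
    Integrable (fun ω ↦ ∫ y in B, D.gaussianDensity s (X ω) t y) P := by
  have hv := hD.condVar_pos hs hst ht
  refine Integrable.of_bound
    (C := ∫ y, isoGaussianPDF (D.condVar s t) (0 : EuclideanSpace ℝ (Fin d)) y)
    ((stronglyMeasurable_setIntegral_isoGaussianPDF (D.condVar s t) B).comp_measurable
      ((continuous_condMean s t).measurable.comp hX)).aestronglyMeasurable
    (Eventually.of_forall fun ω ↦ ?_)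
  set μ := D.condMean s (X ω) t
  have h0 : 0 ≤ ∫ y in B, isoGaussianPDF (D.condVar s t) μ y :=
    integral_nonneg fun y ↦ (isoGaussianPDF_pos hv μ y).le
  change ‖∫ y in B, isoGaussianPDF (D.condVar s t) μ y‖ ≤ _
  rw [Real.norm_of_nonneg h0]
  refine (setIntegral_le_integral (integrable_isoGaussianPDF hv μ)
    (Eventually.of_forall fun y ↦ (isoGaussianPDF_pos hv μ y).le)).trans_eq ?_
  rw [← integral_sub_right_eq_self (isoGaussianPDF (D.condVar s t) 0) μ]
  exact integral_congr_ae (Eventually.of_forall fun y ↦ isoGaussianPDF_eq_sub _ μ y)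

theorem LinearData.IsRegular.isTransitionDensity (hD : D.IsRegular) :
    IsTransitionDensity D.sde D.T D.gaussianDensity := by
  intro Ω mΩ ℱ P X hX s t hs hst ht B hB
  have := hX.isProbabilityMeasure
  have hsT : s ∈ Icc 0 D.T := ⟨hs, hst.le.trans ht⟩
  have htT : t ∈ Icc 0 D.T := ⟨hs.trans hst.le, ht⟩
  have hv := hD.condVar_pos hs hst ht
  have hI : Icc s t ⊆ Icc 0 D.T := Icc_subset_Icc hs ht
  have hXt := hX.measurable htT
  have hXs := hX.measurable hsT
  have hpre : MeasurableSet (X t ⁻¹' B) := hXt hB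
  refine (ae_eq_condExp_of_forall_setIntegral_eq (ℱ.le s)
    ((integrable_const (1 : ℝ)).indicator hpre) (fun A _ _ ↦
      (hD.setIntegral_condMean_integrable hs hst ht hXs B).integrableOn) (fun A hA _ ↦ ?_) ?_).symm
  · have hvl : D.damping t ^ 2 * D.condVar s t
        = ∫ r in s..t, D.damping r ^ 2 * D.sde.diffusion r ^ 2 := by
      rw [LinearData.condVar_eq, LinearData.g2Bar_eq, ← mul_assoc, ← mul_pow,
        mul_inv_cancel₀ (D.damping_pos t).ne', one_pow, one_mul]
      refine intervalIntegral.integral_congr fun r _ ↦ ?_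
      simp only [mul_pow]; rfl
    have hM : ∀ x, D.damping t • D.condMean s x t + -(D.hBar 0 t • D.m) =
        D.damping s • x + -(D.hBar 0 s • D.m) := fun x ↦ by
      rw [LinearData.condMean, hD.exp_fBar_eq hsT htT, LinearData.exp_fBar,
        hD.hBar_eq_sub hsT htT]
      simp only [smul_add, smul_smul, ← mul_assoc, mul_inv_cancel₀ (D.damping_pos t).ne', one_mul,
        sub_smul]
      abel
    have h := hX.restrict_apply_preimage hI hst.le (hD.isDriftlessFrame_sde hs ht) hv hvl
      (continuous_condMean s t) hM hA hB
    simp_rw [lintegral_isoGaussianPDF_eq_ofReal hv] at h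
    have hi : Integrable (fun ω ↦ ∫ y in B, isoGaussianPDF (D.condVar s t)
        (D.condMean s (X s ω) t) y) (P.restrict A) :=
      (hD.setIntegral_condMean_integrable hs hst ht hXs B).integrableOn
    change _ = ∫ ω in A, (X t ⁻¹' B).indicator 1 ω ∂P
    rw [integral_indicator_one hpre, measureReal_def, h,
      ← ofReal_integral_eq_lintegral_ofReal hi
        (Eventually.of_forall fun ω ↦ integral_nonneg fun y ↦ (isoGaussianPDF_pos hv _ y).le),
      ENNReal.toReal_ofReal
        (integral_nonneg fun ω ↦ integral_nonneg fun y ↦ (isoGaussianPDF_pos hv _ y).le)]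
    rfl
  · exact ((stronglyMeasurable_setIntegral_isoGaussianPDF (D.condVar s t) B).comp_measurable
      ((continuous_condMean s t).measurable.comp (hX.adapted s hsT))).aestronglyMeasurable

end TransitionDensity

section Bridge
variable {d : ℕ} {D : LinearData d}

namespace LinearData

/-- The mean of `x_t` given `x_0 = x₀` and `x_T = xT`: in the driftless coordinate it divides the
segment from `x₀` to the target in the ratio of the accumulated to the remaining variance. -/
noncomputable def bridgeMean (D : LinearData d) (xT : EuclideanSpace ℝ (Fin d)) (t : ℝ)
    (x₀ : EuclideanSpace ℝ (Fin d)) : EuclideanSpace ℝ (Fin d) :=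
  (D.damping t)⁻¹ • (D.straighten D.T xT + D.hBar 0 t • D.m +
    (D.g2Bar t D.T / D.g2Bar 0 D.T) • (x₀ - D.straighten D.T xT))

/-- The variance, in each coordinate, of `x_t` given `x_0` and `x_T`. -/
noncomputable def bridgeVar (D : LinearData d) (t : ℝ) : ℝ :=
  (D.damping t)⁻¹ ^ 2 * (D.g2Bar t D.T * D.g2Bar 0 t / D.g2Bar 0 D.T)

namespace IsRegular

lemma bridgeVar_pos (hD : D.IsRegular) {t : ℝ} (ht : t ∈ Ioo 0 D.T) : 0 < D.bridgeVar t := by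
  have := D.damping_pos t
  have := hD.g2Bar_pos ht.1.le ht.2 le_rfl
  have := hD.g2Bar_pos le_rfl ht.1 ht.2.le
  have := hD.g2Bar_pos le_rfl hD.pos le_rfl
  unfold bridgeVar; positivity

lemma gaussianDensity_eq (hD : D.IsRegular) {s t : ℝ} (hs : s ∈ Icc 0 D.T) (ht : t ∈ Icc 0 D.T)
    (x y : EuclideanSpace ℝ (Fin d)) :
    D.gaussianDensity s x t y = (2 * Real.pi * D.condVar s t) ^ (-(d : ℝ) / 2) *
      Real.exp (-‖D.straighten t y - D.straighten s x‖ ^ 2 / (2 * D.g2Bar s t)) := by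
  have := (D.damping_pos t).ne'
  rw [gaussianDensity, hD.straighten_sub_straighten hs ht, norm_smul, condVar_eq,
    Real.norm_of_nonneg (inv_nonneg.2 (D.damping_pos t).le)]
  congr 2
  field_simp

/-- Bayes' formula for the bridge, by completing the square. -/
lemma gaussianDensity_mul_div (hD : D.IsRegular) {t : ℝ} (ht : t ∈ Ioo 0 D.T)
    (x₀ x xT : EuclideanSpace ℝ (Fin d)) :
    D.gaussianDensity 0 x₀ t x * D.gaussianDensity t x D.T xT / D.gaussianDensity 0 x₀ D.T xT =
      isoGaussianPDF (D.bridgeVar t) (D.bridgeMean xT t x₀) x := by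
  have ht' := Ioo_subset_Icc_self ht
  have h1 := hD.g2Bar_pos ht.1.le ht.2 le_rfl
  have h2 := hD.g2Bar_pos le_rfl ht.1 ht.2.le
  have h3 := hD.g2Bar_pos le_rfl hD.pos le_rfl
  have h4 := hD.g2Bar_add hD.zero_mem ht' hD.T_mem
  have v1 := hD.condVar_pos ht.1.le ht.2 le_rfl
  have v2 := hD.condVar_pos le_rfl ht.1 ht.2.le
  have v3 := hD.condVar_pos le_rfl hD.pos le_rfl
  have e1 := D.damping_pos t
  have e2 := D.damping_pos D.T
  rw [hD.gaussianDensity_eq hD.zero_mem ht', hD.gaussianDensity_eq ht' hD.T_mem,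
    hD.gaussianDensity_eq hD.zero_mem hD.T_mem, straighten_zero, isoGaussianPDF,
    mul_mul_mul_comm, mul_div_mul_comm, ← Real.exp_add, ← Real.exp_sub,
    ← Real.mul_rpow (by positivity) (by positivity), ← Real.div_rpow (by positivity)
      (by positivity)]
  congr 2
  · rw [bridgeVar, condVar_eq, condVar_eq, condVar_eq]
    field_simp
  · have hx : x - D.bridgeMean xT t x₀ = (D.damping t)⁻¹ •
        ((D.straighten t x - D.straighten D.T xT) -
          (D.g2Bar t D.T / D.g2Bar 0 D.T) • (x₀ - D.straighten D.T xT)) := by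
      have hsx : D.straighten t x = D.damping t • x - D.hBar 0 t • D.m := rfl
      rw [bridgeMean, hsx, eq_comm]
      simp only [smul_sub, smul_add, smul_smul, inv_mul_cancel₀ e1.ne', one_smul]
      abel
    have hxa : D.straighten t x - x₀ =
      (D.straighten t x - D.straighten D.T xT) - (x₀ - D.straighten D.T xT) := by abel
    rw [hx, hxa, norm_sub_rev (D.straighten D.T xT) (D.straighten t x),
      norm_sub_rev (D.straighten D.T xT) x₀]
    generalize D.straighten t x - D.straighten D.T xT = a
    generalize x₀ - D.straighten D.T xT = b
    rw [norm_smul, Real.norm_of_nonneg (inv_nonneg.2 e1.le), bridgeVar, mul_pow,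
      norm_sub_sq_real, norm_sub_sq_real, norm_smul, real_inner_smul_right, mul_pow,
      Real.norm_of_nonneg (by positivity), ← h4]
    have : 0 < D.g2Bar 0 t + D.g2Bar t D.T := by positivity
    field_simp
    ring

lemma bridgeDensity_eq (hD : D.IsRegular) {t : ℝ} (ht : t ∈ Ioo 0 D.T)
    (ν : Measure (EuclideanSpace ℝ (Fin d))) (xT x : EuclideanSpace ℝ (Fin d)) :
    bridgeDensity D.T D.gaussianDensity ν xT t x =
      ∫ x₀, isoGaussianPDF (D.bridgeVar t) (D.bridgeMean xT t x₀) x ∂ν := by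
  simp only [bridgeDensity, hD.gaussianDensity_mul_div ht]

/-- The drift of the `h`-transform is affine too. With `y = straighten r x` and the remaining
variance `G r`, its driftless coordinate is `(y - y_T) / G r`. -/
lemma isDriftlessFrame_doob (hD : D.IsRegular) (xT : EuclideanSpace ℝ (Fin d)) {S : SDE d}
    (hS : ∀ r ∈ Ico 0 D.T, S.drift r = (D.sde.doob D.T D.gaussianDensity xT).drift r)
    (hSg : S.diffusion = D.g) {t : ℝ} (ht : t < D.T) :
    IsDriftlessFrame S 0 t (fun r ↦ D.f r - (D.damping r * D.g r) ^ 2 / D.g2Bar r D.T)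
      (fun r ↦ D.h r • D.m + (D.g r ^ 2 * D.damping r / D.g2Bar r D.T) •
        (D.straighten D.T xT + D.hBar 0 r • D.m))
      (fun r ↦ D.damping r * (D.g2Bar r D.T)⁻¹)
      (fun r ↦ -((D.g2Bar r D.T)⁻¹ • (D.straighten D.T xT + D.hBar 0 r • D.m))) := by
  have hsub : Icc 0 t ⊆ Icc 0 D.T := Icc_subset_Icc_right ht.le
  have hG : ∀ r ∈ Icc 0 t, 0 < D.g2Bar r D.T := fun r hr ↦
    hD.g2Bar_pos hr.1 (hr.2.trans_lt ht) le_rfl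
  have cG := hD.continuousOn_g2Bar.mono hsub
  have cGi : ContinuousOn (fun r ↦ (D.g2Bar r D.T)⁻¹) (Icc 0 t) := cG.inv₀ fun r hr ↦ (hG r hr).ne'
  have ce := hD.continuousOn_damping.mono hsub
  have cf := hD.continuousOn_f.mono hsub
  have ch := hD.continuousOn_h.mono hsub
  have cg := hD.continuousOn_g.mono hsub
  have cH := hD.continuousOn_hBar.mono hsub
  have cz : ContinuousOn (fun r ↦ D.straighten D.T xT + D.hBar 0 r • D.m) (Icc 0 t) :=
    continuousOn_const.add (cH.smul continuousOn_const)
  have dG : ∀ r ∈ Ico 0 t, HasDerivWithinAt (fun r ↦ (D.g2Bar r D.T)⁻¹)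
      ((D.damping r * D.g r) ^ 2 / D.g2Bar r D.T ^ 2) (Ici r) r := fun r hr ↦ by
    have := (hD.hasDerivWithinAt_g2Bar ⟨hr.1, hr.2.trans ht⟩).fun_inv
      (hG r (Ico_subset_Icc_self hr)).ne'
    rwa [neg_neg] at this
  refine ⟨fun r hr x ↦ ?_, ?_, ?_, ?_, ?_, ce.mul cGi, (cGi.smul cz).neg, fun r hr ↦ ?_,
    fun r hr ↦ ?_⟩
  · have hr' : r ∈ Ico 0 D.T := ⟨hr.1, hr.2.trans_lt ht⟩
    have hGr := (hG r hr).ne'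
    have hsx : D.straighten r x = D.damping r • x - D.hBar 0 r • D.m := rfl
    rw [hS r hr']
    simp only [SDE.doob, doobH, hD.gradient_log_gaussianDensity hr', LinearData.sde, hsx]
    generalize D.straighten D.T xT = y
    match_scalars <;> field_simp
    ring
  · exact cf.sub (((ce.mul cg).pow 2).div cG fun r hr ↦ (hG r hr).ne')
  · exact (ch.smul continuousOn_const).add
      ((((cg.pow 2).mul ce).div cG fun r hr ↦ (hG r hr).ne').smul cz)
  · rw [hSg]; exact cg
  · exact fun r hr ↦ mul_pos (D.damping_pos r) (inv_pos.2 (hG r hr))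
  · have hGr := (hG r (Ico_subset_Icc_self hr)).ne'
    refine ((hD.hasDerivWithinAt_damping ⟨hr.1, hr.2.trans ht⟩).mul (dG r hr)).congr_deriv ?_
    field_simp
    ring
  · have hGr := (hG r (Ico_subset_Icc_self hr)).ne'
    have dz := ((hD.hasDerivWithinAt_hBar ⟨hr.1, hr.2.trans ht⟩).smul_const D.m).const_add
      (D.straighten D.T xT)
    refine ((dG r hr).smul dz).neg.congr_deriv ?_
    match_scalars <;> field_simp

/-- The variance of the driftless coordinate `(y - y_T) / G` is
`∫ (-G') / G² = 1 / G t - 1 / G 0`. -/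
lemma integral_bridge_variance (hD : D.IsRegular) {t : ℝ} (ht : t ∈ Ioo 0 D.T) :
    (D.damping t * (D.g2Bar t D.T)⁻¹) ^ 2 * D.bridgeVar t =
      ∫ r in 0..t, (D.damping r * (D.g2Bar r D.T)⁻¹) ^ 2 * D.g r ^ 2 := by
  have hsub : Icc 0 t ⊆ Icc 0 D.T := Icc_subset_Icc_right ht.2.le
  have hG : ∀ r ∈ Icc 0 t, 0 < D.g2Bar r D.T := fun r hr ↦
    hD.g2Bar_pos hr.1 (hr.2.trans_lt ht.2) le_rfl
  have cG := hD.continuousOn_g2Bar.mono hsub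
  have cGi : ContinuousOn (fun r ↦ (D.g2Bar r D.T)⁻¹) (Icc 0 t) := cG.inv₀ fun r hr ↦ (hG r hr).ne'
  have hn : ContinuousOn (fun r ↦ (D.damping r * (D.g2Bar r D.T)⁻¹) ^ 2 * D.g r ^ 2) (Icc 0 t) :=
    (((hD.continuousOn_damping.mono hsub).mul cGi).pow 2).mul ((hD.continuousOn_g.mono hsub).pow 2)
  rw [integral_eq_sub_of_hasDerivWithinAt_Ici ht.1.le cGi hn fun r hr ↦ ?_]
  · have h0 := (hG 0 (left_mem_Icc.2 ht.1.le)).ne'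
    have h1 := (hG t (right_mem_Icc.2 ht.1.le)).ne'
    have h2 := (D.damping_pos t).ne'
    have h4 := hD.g2Bar_add hD.zero_mem (Ioo_subset_Icc_self ht) hD.T_mem
    rw [bridgeVar]
    field_simp
    linarith
  · have hGr := (hG r (Ico_subset_Icc_self hr)).ne'
    refine ((hD.hasDerivWithinAt_g2Bar ⟨hr.1, hr.2.trans ht.2⟩).fun_inv hGr).congr_deriv ?_
    field_simp

lemma _root_.LinearData.continuous_bridgeMean (xT : EuclideanSpace ℝ (Fin d)) (t : ℝ) :
    Continuous (D.bridgeMean xT t) := by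
  unfold bridgeMean; fun_prop

/-- The marginal laws of a weak solution of the `h`-transform are the bridge mixtures. -/
lemma bridge_law (hD : D.IsRegular) (xT : EuclideanSpace ℝ (Fin d)) {S : SDE d}
    (hS : ∀ r ∈ Ico 0 D.T, S.drift r = (D.sde.doob D.T D.gaussianDensity xT).drift r)
    (hSg : S.diffusion = D.g) {Ω : Type} {mΩ : MeasurableSpace Ω} {ℱ : Filtration ℝ mΩ}
    {P : Measure Ω} {X : ℝ → Ω → EuclideanSpace ℝ (Fin d)}
    (hX : IsWeakSolution S (Ico 0 D.T) ℱ P X) {t : ℝ} (ht : t ∈ Ioo 0 D.T) :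
    P.map (X t) = volume.withDensity fun x ↦
      ENNReal.ofReal (bridgeDensity D.T D.gaussianDensity (P.map (X 0)) xT t x) := by
  have := hX.isProbabilityMeasure
  have hI : Icc 0 t ⊆ Ico 0 D.T := fun r hr ↦ ⟨hr.1, hr.2.trans_lt ht.2⟩
  have hv := hD.bridgeVar_pos ht
  have hX0 := hX.measurable (hI (left_mem_Icc.2 ht.1.le))
  have hXt := hX.measurable (hI (right_mem_Icc.2 ht.1.le))
  have hMm := (continuous_bridgeMean (D := D) xT t).measurable
  have h0 := (hD.g2Bar_pos le_rfl hD.pos le_rfl).ne'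
  have hGt := (hD.g2Bar_pos ht.1.le ht.2 le_rfl).ne'
  have het := (D.damping_pos t).ne'
  have hM : ∀ x, (D.damping t * (D.g2Bar t D.T)⁻¹) • D.bridgeMean xT t x
      + -((D.g2Bar t D.T)⁻¹ • (D.straighten D.T xT + D.hBar 0 t • D.m)) =
      (D.damping 0 * (D.g2Bar 0 D.T)⁻¹) • x
      + -((D.g2Bar 0 D.T)⁻¹ • (D.straighten D.T xT + D.hBar 0 0 • D.m)) := fun x ↦ by
    rw [bridgeMean, damping_zero, show D.hBar 0 0 = 0 by simp [hBar]]
    generalize D.straighten D.T xT = y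
    match_scalars <;> field_simp <;> ring
  have hker : Measurable fun q : EuclideanSpace ℝ (Fin d) × EuclideanSpace ℝ (Fin d) ↦
      ENNReal.ofReal (isoGaussianPDF (D.bridgeVar t) (D.bridgeMean xT t q.1) q.2) :=
    (((continuous_bridgeMean xT t).comp continuous_fst).isoGaussianPDF
      continuous_snd).measurable.ennreal_ofReal
  ext B hB
  have h := hX.restrict_apply_preimage (A := univ) hI ht.1.le
    (hD.isDriftlessFrame_doob xT hS hSg ht.2)
    hv (by rw [hSg]; exact hD.integral_bridge_variance ht) (continuous_bridgeMean xT t) hM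
    MeasurableSet.univ hB
  rw [Measure.restrict_univ] at h
  rw [Measure.map_apply hXt hB, h, withDensity_apply _ hB,
    ← lintegral_map (f := fun x₀ ↦ ∫⁻ y in B,
      ENNReal.ofReal (isoGaussianPDF (D.bridgeVar t) (D.bridgeMean xT t x₀) y))
      (hker.lintegral_prod_right') hX0, lintegral_lintegral_swap hker.aemeasurable]
  refine lintegral_congr fun y ↦ ?_
  have : IsFiniteMeasure (P.map (X 0)) := inferInstance
  rw [hD.bridgeDensity_eq ht, ofReal_integral_eq_lintegral_ofReal]
  · exact integrable_isoGaussianPDF_comp hv (continuous_bridgeMean xT t) _ y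
  · exact Eventually.of_forall fun x₀ ↦ (isoGaussianPDF_pos hv _ y).le

end IsRegular
end LinearData
end Bridge

/-! ### Trajectories of the control problem in the driftless coordinate -/

/-- Integration by parts for primitives of integrable functions, which are merely absolutely
continuous. -/
lemma integral_mul_integral_eq {a b : ℝ → ℝ} {s t : ℝ} (ha : IntervalIntegrable a volume s t)
    (hb : IntervalIntegrable b volume s t) :
    (∫ r in s..t, a r) * (∫ r in s..t, b r) =
      ∫ r in s..t, (a r * (∫ q in s..r, b q) + (∫ q in s..r, a q) * b r) := by
  have h := AbsolutelyContinuousOnInterval.integral_deriv_mul_eq_sub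
    (ha.absolutelyContinuousOnInterval_intervalIntegral (c := s) left_mem_uIcc)
    (hb.absolutelyContinuousOnInterval_intervalIntegral (c := s) left_mem_uIcc)
  rw [intervalIntegral.integral_same, zero_mul, sub_zero] at h
  rw [← h]
  refine intervalIntegral.integral_congr_ae ?_
  filter_upwards [ha.ae_hasDerivAt_integral, hb.ae_hasDerivAt_integral] with r h1 h2 hr
  have hr' := uIoc_subset_uIcc hr
  rw [(h1 hr' s left_mem_uIcc).deriv, (h2 hr' s left_mem_uIcc).deriv]

section Control
variable {d : ℕ} {D : LinearData d}

/-- The inverse of `straighten`. -/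
noncomputable def LinearData.unstraighten (D : LinearData d) (t : ℝ)
    (y : EuclideanSpace ℝ (Fin d)) : EuclideanSpace ℝ (Fin d) :=
  (D.damping t)⁻¹ • (y + D.hBar 0 t • D.m)

lemma LinearData.straighten_unstraighten (t : ℝ) (y : EuclideanSpace ℝ (Fin d)) :
    D.straighten t (D.unstraighten t y) = y := by
  rw [straighten, unstraighten, smul_inv_smul₀ (D.damping_pos t).ne', add_sub_cancel_right]

lemma LinearData.unstraighten_straighten (t : ℝ) (x : EuclideanSpace ℝ (Fin d)) :
    D.unstraighten t (D.straighten t x) = x := by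
  rw [straighten, unstraighten, sub_add_cancel, inv_smul_smul₀ (D.damping_pos t).ne']

lemma IsTrajectory.congr_ae {u v X : ℝ → EuclideanSpace ℝ (Fin d)} {s : ℝ}
    {x : EuclideanSpace ℝ (Fin d)} (h : IsTrajectory D u s x X)
    (huv : u =ᵐ[volume.restrict (Icc s D.T)] v) : IsTrajectory D v s x X := by
  refine ⟨h.1, fun t ht ↦ (h.2 t ht).trans ?_⟩
  congr 1
  refine intervalIntegral.integral_congr_ae ?_
  filter_upwards [(ae_restrict_iff' measurableSet_Icc).1 huv] with r hr hrt
  rw [uIoc_of_le ht.1] at hrt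
  rw [hr ⟨hrt.1.le, hrt.2.trans ht.2⟩]

lemma IsAdmissiblePair.congr_ae {u v X : ℝ → EuclideanSpace ℝ (Fin d)} {s : ℝ}
    {x : EuclideanSpace ℝ (Fin d)} (h : IsAdmissiblePair D s x u X)
    (huv : u =ᵐ[volume.restrict (Icc s D.T)] v) : IsAdmissiblePair D s x v X :=
  ⟨h.1.ae_eq huv, h.2.congr_ae huv⟩

namespace LinearData.IsRegular

lemma _root_.LinearData.intervalIntegrable_of_memLp {u : ℝ → EuclideanSpace ℝ (Fin d)} {s : ℝ}
    (hu : MemLp u 2 (volume.restrict (Icc s D.T))) {t : ℝ} (ht : t ∈ Icc s D.T) :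
    IntervalIntegrable u volume s t := by
  have h : IntegrableOn u (Icc s D.T) := hu.integrable (by norm_num)
  rw [intervalIntegrable_iff_integrableOn_Ioc_of_le ht.1]
  exact h.mono_set (Ioc_subset_Icc_self.trans (Icc_subset_Icc_right ht.2))

/-- In the driftless coordinate a trajectory is the integral of its control. The control is only
square integrable, so the product rule is applied to absolutely continuous functions, coordinate by
coordinate. -/
lemma straighten_trajectory (hD : D.IsRegular) {u X : ℝ → EuclideanSpace ℝ (Fin d)} {s : ℝ}
    (hs : 0 ≤ s) {x : EuclideanSpace ℝ (Fin d)} (h : IsAdmissiblePair D s x u X) {t : ℝ}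
    (ht : t ∈ Icc s D.T) :
    D.straighten t (X t) = D.straighten s x + ∫ r in s..t, (D.damping r * D.g r) • u r := by
  obtain ⟨hu, hXc, hX⟩ := h
  have hsub : uIcc s t ⊆ Icc 0 D.T := by
    rw [uIcc_of_le ht.1]; exact Icc_subset_Icc hs ht.2
  have hsub' : uIcc s t ⊆ Icc s D.T := by
    rw [uIcc_of_le ht.1]; exact Icc_subset_Icc_right ht.2
  have hsT : s ∈ Icc 0 D.T := hsub left_mem_uIcc
  have htT : t ∈ Icc 0 D.T := hsub right_mem_uIcc
  have iu := intervalIntegrable_of_memLp hu ht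
  have cf := hD.continuousOn_f.mono hsub
  have ch := hD.continuousOn_h.mono hsub
  have cg := hD.continuousOn_g.mono hsub
  have ce := hD.continuousOn_damping.mono hsub
  have cX := hXc.mono hsub'
  have iw : IntervalIntegrable (fun r ↦ D.f r • X r + D.h r • D.m + D.g r • u r) volume s t :=
    ((cf.smul cX).add (ch.smul continuousOn_const)).intervalIntegrable.add (iu.continuousOn_smul cg)
  have ik : IntervalIntegrable (fun r ↦ (D.damping r * D.g r) • u r) volume s t :=
    iu.continuousOn_smul (ce.mul cg)
  ext i
  have hproj : ∀ (φ : ℝ → EuclideanSpace ℝ (Fin d)) (r : ℝ), IntervalIntegrable φ volume s r →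
      (∫ q in s..r, φ q) i = ∫ q in s..r, φ q i := fun φ r hφ ↦
    ((EuclideanSpace.proj i : EuclideanSpace ℝ (Fin d) →L[ℝ] ℝ).intervalIntegral_comp_comm hφ).symm
  have hint : ∀ (φ : ℝ → EuclideanSpace ℝ (Fin d)), IntervalIntegrable φ volume s t →
      IntervalIntegrable (fun q ↦ φ q i) volume s t := fun φ hφ ↦
    ⟨(EuclideanSpace.proj i : EuclideanSpace ℝ (Fin d) →L[ℝ] ℝ).integrable_comp hφ.1,
      (EuclideanSpace.proj i : EuclideanSpace ℝ (Fin d) →L[ℝ] ℝ).integrable_comp hφ.2⟩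
  set w : ℝ → ℝ := fun r ↦ (D.f r • X r + D.h r • D.m + D.g r • u r) i with hw
  have iwi : IntervalIntegrable w volume s t := hint _ iw
  have cE : ContinuousOn (fun r ↦ -(D.f r * D.damping r)) (uIcc s t) := (cf.mul ce).neg
  have hE : ∀ r ∈ uIcc s t, ∫ q in s..r, -(D.f q * D.damping q) = D.damping r - D.damping s := by
    intro r hr
    rw [uIcc_of_le ht.1] at hr cE
    refine integral_eq_sub_of_hasDerivWithinAt_Ici hr.1 ?_
      (cE.mono (Icc_subset_Icc_right hr.2)) fun q hq ↦ ?_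
    · exact hD.continuousOn_damping.mono (Icc_subset_Icc hs (hr.2.trans ht.2))
    · exact hD.hasDerivWithinAt_damping
        ⟨hs.trans hq.1, hq.2.trans_le (hr.2.trans ht.2)⟩
  have hXi : ∀ r ∈ uIcc s t, X r i = x i + ∫ q in s..r, w q := by
    intro r hr
    rw [hX r (hsub' hr), PiLp.add_apply, hproj _ r (iw.mono_set (uIcc_subset_uIcc_left hr))]
  have hmul := integral_mul_integral_eq cE.intervalIntegrable iwi
  have hH : ∫ r in s..t, D.damping r * D.h r = D.hBar 0 t - D.hBar 0 s :=
    hD.hBar_eq_sub hsT htT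
  have hsum : ∫ r in s..t, (-(D.f r * D.damping r) * (∫ q in s..r, w q) +
        (∫ q in s..r, -(D.f q * D.damping q)) * w r) =
      ∫ r in s..t, (D.damping r * D.h r * D.m i + (D.damping r * D.g r) * u r i
        - -(D.f r * D.damping r) * x i - D.damping s * w r) := by
    refine intervalIntegral.integral_congr fun r hr ↦ ?_
    have h1 := hXi r hr
    have h2 : ∫ q in s..r, w q = X r i - x i := by linarith
    simp only [hE r hr, h2]
    simp only [hw, PiLp.add_apply, PiLp.smul_apply, smul_eq_mul]
    ring
  have i1 : IntervalIntegrable (fun r ↦ D.damping r * D.h r * D.m i) volume s t :=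
    ((ce.mul ch).mul continuousOn_const).intervalIntegrable
  have i2 : IntervalIntegrable (fun r ↦ (D.damping r * D.g r) * u r i) volume s t := hint _ ik
  have i3 : IntervalIntegrable (fun r ↦ -(D.f r * D.damping r) * x i) volume s t :=
    (cE.mul continuousOn_const).intervalIntegrable
  rw [hsum, intervalIntegral.integral_sub ((i1.add i2).sub i3) (iwi.const_mul _),
    intervalIntegral.integral_sub (i1.add i2) i3, intervalIntegral.integral_add i1 i2,
    intervalIntegral.integral_mul_const, intervalIntegral.integral_mul_const,
    intervalIntegral.integral_const_mul, hE t right_mem_uIcc, hH] at hmul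
  have h3 := hXi t right_mem_uIcc
  rw [PiLp.add_apply, hproj _ t ik]
  simp only [straighten, PiLp.sub_apply, PiLp.smul_apply, smul_eq_mul]
  rw [h3]
  linear_combination hmul

lemma isTrajectory_unstraighten (hD : D.IsRegular) {s : ℝ} (hs : s ∈ Ico 0 D.T)
    {Y u : ℝ → EuclideanSpace ℝ (Fin d)} {x : EuclideanSpace ℝ (Fin d)}
    (hY : ContinuousOn Y (Icc s D.T)) (hu : ContinuousOn u (Icc s D.T))
    (hYu : ∀ r ∈ Ico s D.T, HasDerivWithinAt Y ((D.damping r * D.g r) • u r) (Ici r) r)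
    (hYs : Y s = D.straighten s x) :
    IsTrajectory D u s x fun t ↦ D.unstraighten t (Y t) := by
  have hsub : Icc s D.T ⊆ Icc 0 D.T := Icc_subset_Icc_left hs.1
  have ce : ContinuousOn (fun t ↦ (D.damping t)⁻¹) (Icc s D.T) :=
    (hD.continuousOn_damping.mono hsub).inv₀ fun t _ ↦ (D.damping_pos t).ne'
  have cX : ContinuousOn (fun t ↦ D.unstraighten t (Y t)) (Icc s D.T) :=
    ce.smul (hY.add ((hD.continuousOn_hBar.mono hsub).smul continuousOn_const))
  refine ⟨cX, fun t ht ↦ ?_⟩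
  have hsub' : Icc s t ⊆ Icc s D.T := Icc_subset_Icc_right ht.2
  have cn : ContinuousOn (fun r ↦ D.f r • D.unstraighten r (Y r) + D.h r • D.m + D.g r • u r)
      (Icc s D.T) :=
    (((hD.continuousOn_f.mono hsub).smul cX).add
      ((hD.continuousOn_h.mono hsub).smul continuousOn_const)).add
      ((hD.continuousOn_g.mono hsub).smul hu)
  have h := integral_eq_sub_of_hasDerivWithinAt_Ici ht.1 (cX.mono hsub') (cn.mono hsub')
    fun r hr ↦ ?_
  · simp only [hYs, unstraighten_straighten] at h
    rw [h]; abel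
  · have hr' : r ∈ Ico s D.T := ⟨hr.1, hr.2.trans_le ht.2⟩
    have hr0 : r ∈ Ico 0 D.T := ⟨hs.1.trans hr'.1, hr'.2⟩
    have he := (D.damping_pos r).ne'
    have d1 := (hD.hasDerivWithinAt_damping hr0).fun_inv he
    have d2 := (hYu r hr').add ((hD.hasDerivWithinAt_hBar hr0).smul_const D.m)
    refine (d1.smul d2).congr_deriv ?_
    simp only [unstraighten, Pi.add_apply]
    match_scalars <;> field_simp
    ring

end LinearData.IsRegular
end Control

/-! ### The optimal control for a finite penalty -/

section Optimal
variable {d : ℕ} {D : LinearData d}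

namespace LinearData

/-- The vector `p` for which the optimal control from `(s, x)` is `e^{-f̄_t} g_t p`: the constant
costate of the problem in the driftless coordinate. -/
noncomputable def costate (D : LinearData d) (xT : EuclideanSpace ℝ (Fin d)) (γ s : ℝ)
    (x : EuclideanSpace ℝ (Fin d)) : EuclideanSpace ℝ (Fin d) :=
  (γ / (D.damping D.T ^ 2 + γ * D.g2Bar s D.T)) • (D.straighten D.T xT - D.straighten s x)

namespace IsRegular

lemma _root_.LinearData.g2Bar_nonneg {s t : ℝ} (hst : s ≤ t) : 0 ≤ D.g2Bar s t := by
  rw [g2Bar_eq]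
  exact intervalIntegral.integral_nonneg hst fun r _ ↦ sq_nonneg _

lemma _root_.LinearData.integral_gain_smul (s t : ℝ) (p : EuclideanSpace ℝ (Fin d)) :
    ∫ r in s..t, (D.damping r * D.g r) • ((D.damping r * D.g r) • p) = D.g2Bar s t • p := by
  rw [g2Bar_eq, ← intervalIntegral.integral_smul_const]
  refine intervalIntegral.integral_congr fun r _ ↦ ?_
  simp only [smul_smul, sq]

lemma memLp_gain (hD : D.IsRegular) {s : ℝ} (hs : 0 ≤ s) (p : EuclideanSpace ℝ (Fin d)) :
    MemLp (fun r ↦ (D.damping r * D.g r) • p) 2 (volume.restrict (Icc s D.T)) := by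
  have hc : ContinuousOn (fun r ↦ (D.damping r * D.g r) • p) (Icc s D.T) :=
    (hD.continuousOn_damping_mul_g.mono (Icc_subset_Icc_left hs)).smul continuousOn_const
  obtain ⟨C, hC⟩ := isCompact_Icc.exists_bound_of_continuousOn hc
  refine MemLp.of_bound (hc.aestronglyMeasurable measurableSet_Icc) C ?_
  filter_upwards [ae_restrict_mem measurableSet_Icc] with r hr using hC r hr

/-- The cost, by completion of the square around the control `e^{-f̄_t} g_t p`: this control is
optimal and every other one costs more by at least half its squared distance. -/
lemma controlCost_eq (hD : D.IsRegular) (xT : EuclideanSpace ℝ (Fin d)) {γ s : ℝ} (hγ : 0 < γ)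
    (hs : s ∈ Ico 0 D.T) {x : EuclideanSpace ℝ (Fin d)} {v Y : ℝ → EuclideanSpace ℝ (Fin d)}
    (h : IsAdmissiblePair D s x v Y) :
    controlCost D xT γ s v Y =
      (1 / 2 * ∫ r in Icc s D.T, ‖v r - (D.damping r * D.g r) • D.costate xT γ s x‖ ^ 2) +
      γ / 2 * ((D.damping D.T)⁻¹ ^ 2 * ‖(∫ r in s..D.T, (D.damping r * D.g r) • v r) -
        D.g2Bar s D.T • D.costate xT γ s x‖ ^ 2) +
      1 / 2 * (D.g2Bar s D.T + D.damping D.T ^ 2 / γ) * ‖D.costate xT γ s x‖ ^ 2 := by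
  have hsT : s ≤ D.T := hs.2.le
  have hG := g2Bar_nonneg (D := D) hsT
  have he := D.damping_pos D.T
  have hden : 0 < D.damping D.T ^ 2 + γ * D.g2Bar s D.T := by positivity
  set p := D.costate xT γ s x with hp
  set w := ∫ r in s..D.T, (D.damping r * D.g r) • v r with hw
  have hv := h.1
  have hk := hD.memLp_gain hs.1 p
  have hkv : Integrable (fun r ↦ (D.damping r * D.g r) • v r) (volume.restrict (Icc s D.T)) :=
    IntegrableOn.continuousOn_smul (μ := volume) (K := Icc s D.T)
      (hv.integrable (by norm_num))
      (hD.continuousOn_damping_mul_g.mono (Icc_subset_Icc_left hs.1)) isCompact_Icc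
  -- the terminal deviation, in terms of the costate
  have hterm : Y D.T - xT = (D.damping D.T)⁻¹ •
      ((w - D.g2Bar s D.T • p) - (D.damping D.T ^ 2 / γ) • p) := by
    have h1 := hD.straighten_trajectory hs.1 h (right_mem_Icc.2 hsT)
    have h2 : D.straighten D.T (Y D.T) - D.straighten D.T xT = D.damping D.T • (Y D.T - xT) := by
      simp only [straighten, smul_sub]; abel
    have h3 : D.straighten D.T xT - D.straighten s x =
        (D.g2Bar s D.T + D.damping D.T ^ 2 / γ) • p := by
      rw [hp, costate, smul_smul]
      rw [show (D.g2Bar s D.T + D.damping D.T ^ 2 / γ) *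
        (γ / (D.damping D.T ^ 2 + γ * D.g2Bar s D.T)) = 1 by field_simp; ring, one_smul]
    rw [eq_inv_smul_iff₀ he.ne', ← h2, h1, sub_sub, ← add_smul, ← h3]
    abel
  have hen : ∫ r in s..D.T, (1 / 2 : ℝ) * ‖v r‖ ^ 2 =
      (1 / 2 * ∫ r in Icc s D.T, ‖v r - (D.damping r * D.g r) • p‖ ^ 2) + inner ℝ p w
        - 1 / 2 * D.g2Bar s D.T * ‖p‖ ^ 2 := by
    have e1 : inner ℝ p w = ∫ r in Icc s D.T, inner ℝ p ((D.damping r * D.g r) • v r) := by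
      rw [hw, intervalIntegral.integral_of_le hsT, ← integral_Icc_eq_integral_Ioc,
        integral_inner hkv]
    have e2 : D.g2Bar s D.T * ‖p‖ ^ 2
        = ∫ r in Icc s D.T, (D.damping r * D.g r) ^ 2 * ‖p‖ ^ 2 := by
      rw [g2Bar_eq, intervalIntegral.integral_of_le hsT, ← integral_Icc_eq_integral_Ioc,
        integral_mul_const]
    have i1 : Integrable (fun r ↦ ‖v r - (D.damping r * D.g r) • p‖ ^ 2)
        (volume.restrict (Icc s D.T)) := (hv.sub hk).integrable_norm_pow (by norm_num)
    have i2 : Integrable (fun r ↦ inner ℝ p ((D.damping r * D.g r) • v r))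
        (volume.restrict (Icc s D.T)) := hkv.const_inner p
    have i3 : Integrable (fun r ↦ (D.damping r * D.g r) ^ 2 * ‖p‖ ^ 2)
        (volume.restrict (Icc s D.T)) :=
      (((hD.continuousOn_damping_mul_g.mono (Icc_subset_Icc_left hs.1)).pow 2).mul
        continuousOn_const).integrableOn_compact isCompact_Icc
    have i4 : Integrable (fun r ↦ 1 / 2 * ‖v r - (D.damping r * D.g r) • p‖ ^ 2 +
        inner ℝ p ((D.damping r * D.g r) • v r)) (volume.restrict (Icc s D.T)) :=
      (i1.const_mul _).add i2
    rw [e1, mul_assoc, e2, ← integral_const_mul, ← integral_const_mul,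
      ← integral_add (i1.const_mul _) i2,
      ← integral_sub i4 (i3.const_mul _),
      intervalIntegral.integral_of_le hsT, ← integral_Icc_eq_integral_Ioc]
    refine integral_congr_ae (Eventually.of_forall fun r ↦ ?_)
    simp only
    rw [norm_sub_sq_real, norm_smul, mul_pow, Real.norm_eq_abs, sq_abs, real_inner_smul_right,
      real_inner_smul_right, real_inner_comm p]
    ring
  rw [controlCost, hen, hterm, norm_smul, mul_pow, norm_sub_sq_real, norm_smul,
    real_inner_smul_right, mul_pow, Real.norm_of_nonneg (inv_nonneg.2 he.le),
    Real.norm_of_nonneg (by positivity : 0 ≤ D.damping D.T ^ 2 / γ), inner_sub_left,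
    real_inner_smul_left, real_inner_self_eq_norm_sq, real_inner_comm p]
  field_simp
  ring

/-- The state at time `t` under the control `e^{-f̄_r} g_r p` started at `(s, x)`. -/
noncomputable def _root_.LinearData.optimalState (D : LinearData d)
    (p : EuclideanSpace ℝ (Fin d)) (s : ℝ) (x : EuclideanSpace ℝ (Fin d)) (t : ℝ) :
    EuclideanSpace ℝ (Fin d) :=
  D.unstraighten t (D.straighten s x + (D.g2Bar s D.T - D.g2Bar t D.T) • p)

lemma isAdmissiblePair_gain (hD : D.IsRegular) {s : ℝ} (hs : s ∈ Ico 0 D.T)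
    (x p : EuclideanSpace ℝ (Fin d)) :
    IsAdmissiblePair D s x (fun r ↦ (D.damping r * D.g r) • p) (D.optimalState p s x) := by
  have hsub : Icc s D.T ⊆ Icc 0 D.T := Icc_subset_Icc_left hs.1
  refine ⟨hD.memLp_gain hs.1 p, hD.isTrajectory_unstraighten hs ?_ ?_ (fun r hr ↦ ?_) ?_⟩
  · exact continuousOn_const.add ((continuousOn_const.sub
      (hD.continuousOn_g2Bar.mono hsub)).smul continuousOn_const)
  · exact (hD.continuousOn_damping_mul_g.mono hsub).smul continuousOn_const
  · refine ((((hD.hasDerivWithinAt_g2Bar ⟨hs.1.trans hr.1, hr.2⟩).const_sub _).smul_const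
      p).const_add _).congr_deriv ?_
    rw [smul_smul, neg_neg, sq]
  · simp

lemma isOptimalPair_of_ae_eq (hD : D.IsRegular) (xT : EuclideanSpace ℝ (Fin d)) {γ s : ℝ}
    (hγ : 0 < γ) (hs : s ∈ Ico 0 D.T) {x : EuclideanSpace ℝ (Fin d)}
    {u : ℝ → EuclideanSpace ℝ (Fin d)}
    (hu : u =ᵐ[volume.restrict (Icc s D.T)] fun r ↦ (D.damping r * D.g r) • D.costate xT γ s x) :
    IsOptimalPair D xT γ s x u (D.optimalState (D.costate xT γ s x) s x) := by
  have ha := (hD.isAdmissiblePair_gain hs x (D.costate xT γ s x)).congr_ae hu.symm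
  refine ⟨ha, fun v Y hvY ↦ ?_⟩
  rw [hD.controlCost_eq xT hγ hs ha, hD.controlCost_eq xT hγ hs hvY]
  have h1 : ∫ r in Icc s D.T, ‖u r - (D.damping r * D.g r) • D.costate xT γ s x‖ ^ 2 = 0 := by
    rw [integral_congr_ae (g := 0) (hu.mono fun r hr ↦ by simp [hr])]
    simp
  have h2 : ∫ r in s..D.T, (D.damping r * D.g r) • u r = D.g2Bar s D.T • D.costate xT γ s x := by
    rw [← integral_gain_smul]
    refine intervalIntegral.integral_congr_ae ?_
    filter_upwards [(ae_restrict_iff' measurableSet_Icc).1 hu] with r hr hrt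
    rw [uIoc_of_le hs.2.le] at hrt
    rw [hr (Ioc_subset_Icc_self hrt)]
  rw [h1, h2]
  simp only [sub_self, norm_zero, mul_zero, zero_add, ne_eq, OfNat.ofNat_ne_zero, not_false_eq_true,
    zero_pow]
  have h3 : 0 ≤ ∫ r in Icc s D.T, ‖v r - (D.damping r * D.g r) • D.costate xT γ s x‖ ^ 2 :=
    integral_nonneg fun r ↦ by positivity
  refine le_add_of_nonneg_left ?_
  positivity

lemma ae_eq_of_isOptimalPair (hD : D.IsRegular) {xT : EuclideanSpace ℝ (Fin d)} {γ s : ℝ}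
    (hγ : 0 < γ) (hs : s ∈ Ico 0 D.T) {x : EuclideanSpace ℝ (Fin d)}
    {u X : ℝ → EuclideanSpace ℝ (Fin d)} (h : IsOptimalPair D xT γ s x u X) :
    u =ᵐ[volume.restrict (Icc s D.T)] fun r ↦ (D.damping r * D.g r) • D.costate xT γ s x := by
  have hu : ∀ᵐ r ∂volume.restrict (Icc s D.T), (fun r ↦ (D.damping r * D.g r) •
      D.costate xT γ s x) r = (fun r ↦ (D.damping r * D.g r) • D.costate xT γ s x) r :=
    Eventually.of_forall fun _ ↦ rfl
  have hopt := hD.isOptimalPair_of_ae_eq xT hγ hs hu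
  have hle := h.2 _ _ hopt.1
  rw [hD.controlCost_eq xT hγ hs h.1, hD.controlCost_eq xT hγ hs hopt.1,
    integral_gain_smul] at hle
  simp only [sub_self, norm_zero, mul_zero, ne_eq, OfNat.ofNat_ne_zero, not_false_eq_true,
    zero_pow, integral_zero, zero_add] at hle
  have hint : Integrable (fun r ↦ ‖u r - (D.damping r * D.g r) • D.costate xT γ s x‖ ^ 2)
      (volume.restrict (Icc s D.T)) :=
    (h.1.1.sub (hD.memLp_gain hs.1 _)).integrable_norm_pow (by norm_num)
  have h0 : 0 ≤ ∫ r in Icc s D.T, ‖u r - (D.damping r * D.g r) • D.costate xT γ s x‖ ^ 2 :=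
    integral_nonneg fun r ↦ by positivity
  have h1 : 0 ≤ γ / 2 * ((D.damping D.T)⁻¹ ^ 2 * ‖(∫ r in s..D.T, (D.damping r * D.g r) • u r) -
        D.g2Bar s D.T • D.costate xT γ s x‖ ^ 2) := by positivity
  have h2 : ∫ r in Icc s D.T, ‖u r - (D.damping r * D.g r) • D.costate xT γ s x‖ ^ 2 = 0 := by
    linarith
  refine ((integral_eq_zero_iff_of_nonneg (fun r ↦ by positivity) hint).1 h2).mono fun r hr ↦ ?_
  have hr' : ‖u r - (D.damping r * D.g r) • D.costate xT γ s x‖ ^ 2 = 0 := hr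
  simpa [sub_eq_zero] using hr'

lemma eq_optimalState_of_ae_eq (hD : D.IsRegular) {s : ℝ} (hs : s ∈ Ico 0 D.T)
    {x p : EuclideanSpace ℝ (Fin d)} {u X : ℝ → EuclideanSpace ℝ (Fin d)}
    (h : IsAdmissiblePair D s x u X)
    (hu : u =ᵐ[volume.restrict (Icc s D.T)] fun r ↦ (D.damping r * D.g r) • p) {t : ℝ}
    (ht : t ∈ Icc s D.T) : X t = D.optimalState p s x t := by
  have h1 := hD.straighten_trajectory hs.1 (h.congr_ae hu) ht
  have hs' := Ico_subset_Icc_self hs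
  have ht' : t ∈ Icc 0 D.T := ⟨hs.1.trans ht.1, ht.2⟩
  rw [integral_gain_smul] at h1
  rw [optimalState, ← hD.g2Bar_add hs' ht' hD.T_mem, add_sub_cancel_right, ← h1,
    unstraighten_straighten]

/-- The optimal feedback controller: the optimal control from `(t, x)`, evaluated at time `t`. -/
noncomputable def _root_.LinearData.optimalFeedback (D : LinearData d)
    (xT : EuclideanSpace ℝ (Fin d)) (γ t : ℝ) (x : EuclideanSpace ℝ (Fin d)) :
    EuclideanSpace ℝ (Fin d) :=
  (D.damping t * D.g t) • D.costate xT γ t x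

/-- The costate is constant along the optimal trajectory, so the feedback reproduces the open-loop
optimal control. -/
lemma _root_.LinearData.costate_optimalState (xT : EuclideanSpace ℝ (Fin d)) {γ s t : ℝ}
    (hγ : 0 < γ) (hs : s ∈ Ico 0 D.T) (ht : t ∈ Icc s D.T) (x : EuclideanSpace ℝ (Fin d)) :
    D.costate xT γ t (D.optimalState (D.costate xT γ s x) s x t) = D.costate xT γ s x := by
  have he := D.damping_pos D.T
  have h1 := g2Bar_nonneg (D := D) hs.2.le
  have h2 := g2Bar_nonneg (D := D) ht.2
  have h3 : 0 < D.damping D.T ^ 2 + γ * D.g2Bar s D.T := by positivity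
  have h4 : 0 < D.damping D.T ^ 2 + γ * D.g2Bar t D.T := by positivity
  rw [costate, optimalState, straighten_unstraighten, costate]
  generalize D.straighten D.T xT = y
  generalize D.straighten s x = z
  match_scalars <;> field_simp <;> ring

lemma continuousOn_optimalFeedback (hD : D.IsRegular) (xT : EuclideanSpace ℝ (Fin d)) {γ : ℝ}
    (hγ : 0 < γ) : ContinuousOn (fun q : ℝ × EuclideanSpace ℝ (Fin d) ↦
      D.optimalFeedback xT γ q.1 q.2) (Icc 0 D.T ×ˢ univ) := by
  have hfst : MapsTo Prod.fst (Icc 0 D.T ×ˢ (univ : Set (EuclideanSpace ℝ (Fin d))))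
    (Icc 0 D.T) := fun q hq ↦ hq.1
  have c1 := hD.continuousOn_damping_mul_g.comp continuousOn_fst hfst
  have c2 := hD.continuousOn_damping.comp continuousOn_fst hfst
  have c3 := hD.continuousOn_hBar.comp continuousOn_fst hfst
  have c4 := hD.continuousOn_g2Bar.comp continuousOn_fst hfst
  refine c1.smul (ContinuousOn.smul (continuousOn_const.div
    (continuousOn_const.add (continuousOn_const.mul c4)) fun q hq ↦ ?_)
    (continuousOn_const.sub ((c2.smul continuousOn_snd).sub (c3.smul continuousOn_const))))
  have he := D.damping_pos D.T
  have := g2Bar_nonneg (D := D) hq.1.2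
  exact (by positivity : 0 < D.damping D.T ^ 2 + γ * D.g2Bar q.1 D.T).ne'

lemma isOptimalFeedback_optimalFeedback (hD : D.IsRegular) (xT : EuclideanSpace ℝ (Fin d)) {γ : ℝ}
    (hγ : 0 < γ) : IsOptimalFeedback D xT γ (D.optimalFeedback xT γ) := by
  refine ⟨hD.continuousOn_optimalFeedback xT hγ, fun s hs x ↦
    ⟨_, hD.isOptimalPair_of_ae_eq xT hγ hs ?_⟩⟩
  filter_upwards [ae_restrict_mem measurableSet_Icc] with r hr
  rw [optimalFeedback, costate_optimalState xT hγ hs hr]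

/-- A continuous feedback generates a continuous control that agrees almost everywhere, hence
everywhere, with the optimal one, in particular at the initial time; time `T` follows by
continuity. -/
lemma eq_optimalFeedback (hD : D.IsRegular) {xT : EuclideanSpace ℝ (Fin d)} {γ : ℝ}
    (hγ : 0 < γ) {V : ℝ → EuclideanSpace ℝ (Fin d) → EuclideanSpace ℝ (Fin d)}
    (hV : IsOptimalFeedback D xT γ V) {t : ℝ} (ht : t ∈ Icc 0 D.T) (x : EuclideanSpace ℝ (Fin d)) :
    V t x = D.optimalFeedback xT γ t x := by
  have hlt : ∀ s ∈ Ico 0 D.T, V s x = D.optimalFeedback xT γ s x := by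
    intro s hs
    obtain ⟨X, hX⟩ := hV.2 s hs x
    have hsub : Icc s D.T ⊆ Icc 0 D.T := Icc_subset_Icc_left hs.1
    have hXs : X s = x := by
      rw [hX.1.2.2 s (left_mem_Icc.2 hs.2.le), intervalIntegral.integral_same, add_zero]
    have hae := hD.ae_eq_of_isOptimalPair hγ hs hX
    have c1 : ContinuousOn (fun r ↦ V r (X r)) (Icc s D.T) :=
      hV.1.comp (continuousOn_id.prodMk hX.1.2.1) fun r hr ↦ ⟨hsub hr, mem_univ _⟩
    have c2 : ContinuousOn (fun r ↦ (D.damping r * D.g r) • D.costate xT γ s x) (Icc s D.T) :=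
      (hD.continuousOn_damping_mul_g.mono hsub).smul continuousOn_const
    have := Measure.eqOn_Icc_of_ae_eq volume hs.2.ne hae c1 c2 (left_mem_Icc.2 hs.2.le)
    simp only [hXs] at this
    exact this
  rcases ht.2.lt_or_eq with h | rfl
  · exact hlt t ⟨ht.1, h⟩
  have hc : ∀ W : ℝ → EuclideanSpace ℝ (Fin d) → EuclideanSpace ℝ (Fin d),
      ContinuousOn (fun q : ℝ × EuclideanSpace ℝ (Fin d) ↦ W q.1 q.2) (Icc 0 D.T ×ˢ univ) →
      Tendsto (fun s ↦ W s x) (𝓝[<] D.T) (𝓝 (W D.T x)) := fun W hW ↦ by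
    have : ContinuousOn (fun s ↦ W s x) (Icc 0 D.T) :=
      hW.comp (continuousOn_id.prodMk continuousOn_const) fun r hr ↦ ⟨hr, mem_univ _⟩
    exact (this D.T hD.T_mem).mono_of_mem_nhdsWithin (s := Iio D.T) (Icc_mem_nhdsLT hD.pos)
  refine tendsto_nhds_unique ((hc V hV.1).congr' ?_)
    (hc _ (hD.continuousOn_optimalFeedback xT hγ))
  filter_upwards [Ico_mem_nhdsLT hD.pos] with s hs
  exact hlt s hs

lemma tendsto_costate (hD : D.IsRegular) (xT : EuclideanSpace ℝ (Fin d)) {t : ℝ}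
    (ht : t ∈ Ico 0 D.T) (x : EuclideanSpace ℝ (Fin d)) :
    Tendsto (fun γ ↦ D.costate xT γ t x) atTop
      (𝓝 ((D.g2Bar t D.T)⁻¹ • (D.straighten D.T xT - D.straighten t x))) := by
  have hG := hD.g2Bar_pos ht.1 ht.2 le_rfl
  refine Tendsto.smul_const ?_ _
  have h1 : Tendsto (fun γ : ℝ ↦ (D.damping D.T ^ 2 * γ⁻¹ + D.g2Bar t D.T)⁻¹) atTop
      (𝓝 (D.damping D.T ^ 2 * 0 + D.g2Bar t D.T)⁻¹) :=
    ((tendsto_inv_atTop_zero.const_mul _).add_const _).inv₀ (by simpa using hG.ne')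
  rw [mul_zero, zero_add] at h1
  refine h1.congr' ?_
  filter_upwards [eventually_gt_atTop 0] with γ hγ
  field_simp

end IsRegular
end LinearData
end Optimal

/-! ### Regularity of the bridge density and the limit of infinite penalty -/

section BridgeRegularity
variable {d : ℕ} {D : LinearData d}

lemma hasFDerivAt_isoGaussianPDF (v : ℝ) (μ x : EuclideanSpace ℝ (Fin d)) :
    HasFDerivAt (isoGaussianPDF v μ) ((-(isoGaussianPDF v μ x / v)) • innerSL ℝ (x - μ)) x := by
  have h1 : HasFDerivAt (fun y ↦ y - μ) (ContinuousLinearMap.id ℝ (EuclideanSpace ℝ (Fin d))) x :=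
    (hasFDerivAt_id x).sub_const μ
  have h2 := ((h1.norm_sq.const_mul (-(2 * v)⁻¹)).exp).const_mul ((2 * Real.pi * v) ^
      (-(d : ℝ) / 2))
  have e : ∀ y, isoGaussianPDF v μ y = (2 * Real.pi * v) ^ (-(d : ℝ) / 2) *
      Real.exp (-(2 * v)⁻¹ * ‖y - μ‖ ^ 2) := fun y ↦ by
    rw [isoGaussianPDF]
    congr 2
    ring
  have h3 := h2.congr_of_eventuallyEq (Eventually.of_forall e)
  refine h3.congr_fderiv ?_
  rw [e]
  ext z
  simp only [smul_apply, ContinuousLinearMap.comp_id, smul_eq_mul, nsmul_eq_mul, mul_inv]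
  push_cast
  ring

lemma norm_fderiv_isoGaussianPDF_le {v : ℝ} (hv : 0 < v) (μ x : EuclideanSpace ℝ (Fin d)) :
    ‖(-(isoGaussianPDF v μ x / v)) • innerSL ℝ (x - μ)‖ ≤
      (2 * Real.pi * v) ^ (-(d : ℝ) / 2) / v * (1 + 2 * v) := by
  rw [norm_smul, innerSL_apply_norm, norm_neg,
    Real.norm_of_nonneg (div_nonneg (isoGaussianPDF_pos hv μ x).le hv.le), isoGaussianPDF,
    neg_div (2 * v) (‖x - μ‖ ^ 2), Real.exp_neg]
  set r := ‖x - μ‖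
  have hr : 0 ≤ r := norm_nonneg _
  have h1 : r ≤ (1 + 2 * v) * Real.exp (r ^ 2 / (2 * v)) := by
    have h2 : r ^ 2 / (2 * v) + 1 ≤ Real.exp (r ^ 2 / (2 * v)) := Real.add_one_le_exp _
    have h3 : (1 + 2 * v) * (r ^ 2 / (2 * v) + 1) = r ^ 2 / (2 * v) + r ^ 2 + 1 + 2 * v := by
      field_simp; ring
    have h4 : 0 ≤ r ^ 2 / (2 * v) := by positivity
    have h5 := mul_le_mul_of_nonneg_left h2 (by positivity : 0 ≤ 1 + 2 * v)
    nlinarith [sq_nonneg (r - 1)]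
  have h6 : (Real.exp (r ^ 2 / (2 * v)))⁻¹ * r ≤ 1 + 2 * v := by
    rw [inv_mul_le_iff₀ (Real.exp_pos _), mul_comm]; exact h1
  calc _ = (2 * Real.pi * v) ^ (-(d : ℝ) / 2) / v * ((Real.exp (r ^ 2 / (2 * v)))⁻¹ * r) := by ring
    _ ≤ _ := mul_le_mul_of_nonneg_left h6 (by positivity)

lemma differentiable_integral_isoGaussianPDF {v : ℝ} (hv : 0 < v)
    {M : EuclideanSpace ℝ (Fin d) → EuclideanSpace ℝ (Fin d)} (hM : Continuous M)
    (ν : Measure (EuclideanSpace ℝ (Fin d))) [IsFiniteMeasure ν] :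
    Differentiable ℝ fun x ↦ ∫ x₀, isoGaussianPDF v (M x₀) x ∂ν := by
  have hcont : ∀ x, Continuous fun x₀ ↦ isoGaussianPDF v (M x₀) x := fun x ↦
    hM.isoGaussianPDF continuous_const
  intro x
  let F' : EuclideanSpace ℝ (Fin d) → EuclideanSpace ℝ (Fin d) → EuclideanSpace ℝ (Fin d) →L[ℝ] ℝ :=
    fun y x₀ ↦ (-(isoGaussianPDF v (M x₀) y / v)) • innerSL ℝ (y - M x₀)
  have h1 : ∀ᶠ y in 𝓝 x, AEStronglyMeasurable (fun x₀ ↦ isoGaussianPDF v (M x₀) y) ν :=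
    Eventually.of_forall fun y ↦ (hcont y).aestronglyMeasurable
  have h2 : Continuous (F' x) :=
    ((hcont x).div_const v).neg.smul ((innerSL ℝ).continuous.comp (continuous_const.sub hM))
  have h3 : ∀ᵐ x₀ ∂ν, ∀ y ∈ univ,
      ‖F' y x₀‖ ≤ (2 * Real.pi * v) ^ (-(d : ℝ) / 2) / v * (1 + 2 * v) :=
    Eventually.of_forall fun x₀ y _ ↦ norm_fderiv_isoGaussianPDF_le hv (M x₀) y
  have h4 : ∀ᵐ x₀ ∂ν, ∀ y ∈ univ,
      HasFDerivAt (fun y ↦ isoGaussianPDF v (M x₀) y) (F' y x₀) y :=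
    Eventually.of_forall fun x₀ y _ ↦ hasFDerivAt_isoGaussianPDF v (M x₀) y
  exact (hasFDerivAt_integral_of_dominated_of_fderiv_le univ_mem h1
    (integrable_isoGaussianPDF_comp hv hM ν x) h2.aestronglyMeasurable h3
    (integrable_const _) h4).differentiableAt

lemma integral_isoGaussianPDF_pos {v : ℝ} (hv : 0 < v)
    {M : EuclideanSpace ℝ (Fin d) → EuclideanSpace ℝ (Fin d)} (hM : Continuous M)
    (ν : Measure (EuclideanSpace ℝ (Fin d))) [IsProbabilityMeasure ν]
    (x : EuclideanSpace ℝ (Fin d)) : 0 < ∫ x₀, isoGaussianPDF v (M x₀) x ∂ν := by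
  rw [integral_pos_iff_support_of_nonneg (fun x₀ ↦ (isoGaussianPDF_pos hv _ x).le)
    (integrable_isoGaussianPDF_comp hv hM ν x)]
  have : Function.support (fun x₀ ↦ isoGaussianPDF v (M x₀) x) = univ :=
    eq_univ_of_forall fun x₀ ↦ (isoGaussianPDF_pos hv _ x).ne'
  rw [this, measure_univ]
  exact one_pos

lemma IsMarginalDensity.eq_of_eq {Ω : Type} {mΩ : MeasurableSpace Ω} {P : Measure Ω}
    {X : ℝ → Ω → EuclideanSpace ℝ (Fin d)} {I : Set ℝ}
    {q q' : ℝ → EuclideanSpace ℝ (Fin d) → ℝ} (h : IsMarginalDensity P X I q)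
    (h' : IsMarginalDensity P X I q') {t : ℝ} (ht : t ∈ I) : q t = q' t := by
  obtain ⟨c1, p1, e1⟩ := h t ht
  obtain ⟨c2, p2, e2⟩ := h' t ht
  rw [e1, withDensity_eq_iff_of_sigmaFinite c1.measurable.ennreal_ofReal.aemeasurable
    c2.measurable.ennreal_ofReal.aemeasurable] at e2
  refine (Continuous.ae_eq_iff_eq volume c1 c2).1 (e2.mono fun x hx ↦ ?_)
  exact (ENNReal.ofReal_eq_ofReal_iff (p1 x) (p2 x)).1 hx

end BridgeRegularity

section HardConstraint
variable {d : ℕ} {D : LinearData d}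
namespace LinearData.IsRegular

lemma tendsto_optimalFeedback (hD : D.IsRegular) (xT : EuclideanSpace ℝ (Fin d)) {t : ℝ}
    (ht : t ∈ Ico 0 D.T) (x : EuclideanSpace ℝ (Fin d)) :
    Tendsto (fun γ ↦ D.optimalFeedback xT γ t x) atTop
      (𝓝 (D.g t • gradient (fun z ↦ Real.log (D.gaussianDensity t z D.T xT)) x)) := by
  have h := (hD.tendsto_costate xT ht x).const_smul (D.damping t * D.g t)
  rw [hD.gradient_log_gaussianDensity ht, smul_smul]
  rw [smul_smul] at h
  rwa [show D.g t * (D.damping t / D.g2Bar t D.T) =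
    D.damping t * D.g t * (D.g2Bar t D.T)⁻¹ by ring]

/-- Along the straight line from `x₀` to the target in the driftless coordinate, `g ∇ log p` is the
control that generates this line. -/
lemma gradient_optimalState (hD : D.IsRegular) (xT x₀ : EuclideanSpace ℝ (Fin d)) {t : ℝ}
    (ht : t ∈ Ico 0 D.T) :
    D.g t • gradient (fun z ↦ Real.log (D.gaussianDensity t z D.T xT))
      (D.optimalState ((D.g2Bar 0 D.T)⁻¹ • (D.straighten D.T xT - x₀)) 0 x₀ t) =
    (D.damping t * D.g t) • ((D.g2Bar 0 D.T)⁻¹ • (D.straighten D.T xT - x₀)) := by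
  have h1 := (hD.g2Bar_pos ht.1 ht.2 le_rfl).ne'
  have h2 := (hD.g2Bar_pos le_rfl hD.pos le_rfl).ne'
  rw [hD.gradient_log_gaussianDensity ht, optimalState, straighten_unstraighten, straighten_zero]
  generalize D.straighten D.T xT = y
  match_scalars <;> field_simp <;> ring

lemma optimalState_terminal (hD : D.IsRegular) (xT x₀ : EuclideanSpace ℝ (Fin d)) :
    D.optimalState ((D.g2Bar 0 D.T)⁻¹ • (D.straighten D.T xT - x₀)) 0 x₀ D.T = xT := by
  have h2 := (hD.g2Bar_pos le_rfl hD.pos le_rfl).ne'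
  have h3 : D.g2Bar D.T D.T = 0 := by simp [g2Bar]
  rw [optimalState, straighten_zero, h3, sub_zero, smul_inv_smul₀ h2, add_sub_cancel,
    unstraighten_straighten]

lemma _root_.LinearData.continuous_optimalState (s : ℝ) (x : EuclideanSpace ℝ (Fin d)) (t : ℝ) :
    Continuous fun p ↦ D.optimalState p s x t := by
  unfold optimalState unstraighten; fun_prop

lemma tendsto_eLpNorm_gain (hD : D.IsRegular) {p : ℝ → EuclideanSpace ℝ (Fin d)}
    {q : EuclideanSpace ℝ (Fin d)} (hp : Tendsto p atTop (𝓝 q)) :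
    Tendsto (fun γ ↦ eLpNorm (fun t ↦ (D.damping t * D.g t) • (p γ - q)) 2
      (volume.restrict (Icc 0 D.T))) atTop (𝓝 0) := by
  obtain ⟨C, hC⟩ := isCompact_Icc.exists_bound_of_continuousOn hD.continuousOn_damping_mul_g
  have hC0 : 0 ≤ C := (norm_nonneg _).trans (hC 0 hD.zero_mem)
  have hb : ∀ γ, eLpNorm (fun t ↦ (D.damping t * D.g t) • (p γ - q)) 2
      (volume.restrict (Icc 0 D.T)) ≤
      (volume.restrict (Icc 0 D.T)) univ ^ ((2 : ENNReal).toReal)⁻¹ *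
        ENNReal.ofReal (C * ‖p γ - q‖) := fun γ ↦ by
    refine eLpNorm_le_of_ae_bound ?_
    filter_upwards [ae_restrict_mem measurableSet_Icc] with t ht
    rw [norm_smul]
    exact mul_le_mul_of_nonneg_right (hC t ht) (norm_nonneg _)
  have h1 : Tendsto (fun γ ↦ C * ‖p γ - q‖) atTop (𝓝 0) := by
    simpa using (tendsto_iff_norm_sub_tendsto_zero.1 hp).const_mul C
  have h2 := ENNReal.Tendsto.const_mul (a := (volume.restrict (Icc 0 D.T)) univ ^
    ((2 : ENNReal).toReal)⁻¹) (ENNReal.tendsto_ofReal h1) (Or.inr (by finiteness))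
  rw [ENNReal.ofReal_zero, mul_zero] at h2
  exact tendsto_of_tendsto_of_tendsto_of_le_of_le tendsto_const_nhds h2 (fun _ ↦ zero_le) hb

/-- As the penalty tends to infinity, the optimal pairs converge to the pair of minimal energy that
hits the target. -/
theorem tendsto_isOptimalPair (hD : D.IsRegular) (xT x₀ : EuclideanSpace ℝ (Fin d))
    {u X : ℝ → ℝ → EuclideanSpace ℝ (Fin d)}
    (h : ∀ γ : ℝ, 0 < γ → IsOptimalPair D xT γ 0 x₀ (u γ) (X γ)) :
    ∃ Xinf : ℝ → EuclideanSpace ℝ (Fin d),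
      (∀ t ∈ Icc 0 D.T, Tendsto (fun γ ↦ X γ t) atTop (𝓝 (Xinf t))) ∧
      Tendsto (fun γ ↦ eLpNorm (fun t ↦ u γ t - D.g t •
          gradient (fun z ↦ Real.log (D.gaussianDensity t z D.T xT)) (Xinf t))
        2 (volume.restrict (Icc 0 D.T))) atTop (𝓝 0) ∧
      IsAdmissiblePair D 0 x₀ (fun t ↦ D.g t •
          gradient (fun z ↦ Real.log (D.gaussianDensity t z D.T xT)) (Xinf t)) Xinf ∧
      Xinf D.T = xT := by
  have h0 : (0 : ℝ) ∈ Ico 0 D.T := left_mem_Ico.2 hD.pos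
  have hp := hD.tendsto_costate xT h0 x₀
  rw [straighten_zero] at hp
  have hgrad : (fun t ↦ (D.damping t * D.g t) •
      ((D.g2Bar 0 D.T)⁻¹ • (D.straighten D.T xT - x₀))) =ᵐ[volume.restrict (Icc 0 D.T)]
      fun t ↦ D.g t • gradient (fun z ↦ Real.log (D.gaussianDensity t z D.T xT))
      (D.optimalState ((D.g2Bar 0 D.T)⁻¹ • (D.straighten D.T xT - x₀)) 0 x₀ t) := by
    rw [← restrict_Ico_eq_restrict_Icc]
    filter_upwards [ae_restrict_mem measurableSet_Ico] with t ht
    rw [hD.gradient_optimalState xT x₀ ht]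
  refine ⟨D.optimalState ((D.g2Bar 0 D.T)⁻¹ • (D.straighten D.T xT - x₀)) 0 x₀,
    fun t ht ↦ ?_, ?_, (hD.isAdmissiblePair_gain h0 x₀ _).congr_ae hgrad,
    hD.optimalState_terminal xT x₀⟩
  · refine (((continuous_optimalState 0 x₀ t).tendsto _).comp hp).congr' ?_
    filter_upwards [eventually_gt_atTop 0] with γ hγ
    exact (hD.eq_optimalState_of_ae_eq h0 (h γ hγ).1
      (hD.ae_eq_of_isOptimalPair hγ h0 (h γ hγ)) ht).symm
  · refine (hD.tendsto_eLpNorm_gain hp).congr' ?_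
    filter_upwards [eventually_gt_atTop 0] with γ hγ
    refine eLpNorm_congr_ae ?_
    filter_upwards [hD.ae_eq_of_isOptimalPair hγ h0 (h γ hγ), hgrad] with t h1 h2
    rw [h1, ← h2, smul_sub]

end LinearData.IsRegular
end HardConstraint

theorem theorem4p2 {d : ℕ} (D : LinearData d) (hT : 0 < D.T)
    (hf : ContinuousOn D.f (Icc 0 D.T)) (hh : ContinuousOn D.h (Icc 0 D.T))
    (hg : ContinuousOn D.g (Icc 0 D.T))
    (hg0 : ∀ s t, 0 ≤ s → s < t → t ≤ D.T → ∃ r ∈ Ioo s t, D.g r ≠ 0)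
    (xT : EuclideanSpace ℝ (Fin d)) :
    -- the Gaussian density is the transition density of the uncontrolled linear SDE
    IsTransitionDensity D.sde D.T D.gaussianDensity ∧
    -- for finite `γ` there is exactly one optimal controller in feedback form
    (∀ γ : ℝ, 0 < γ → ∃ U, IsOptimalFeedback D xT γ U ∧
      ∀ V, IsOptimalFeedback D xT γ V → ∀ t ∈ Icc 0 D.T, ∀ x, V t x = U t x) ∧
    -- the limit of the optimal controllers, and the SDEs it generates
    (∀ U : ℝ → ℝ → EuclideanSpace ℝ (Fin d) → EuclideanSpace ℝ (Fin d),
      (∀ γ : ℝ, 0 < γ → IsOptimalFeedback D xT γ (U γ)) →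
      ∃ Uinf : ℝ → EuclideanSpace ℝ (Fin d) → EuclideanSpace ℝ (Fin d),
        (∀ t ∈ Ico 0 D.T, ∀ x, Tendsto (fun γ ↦ U γ t x) atTop (𝓝 (Uinf t x))) ∧
        (∀ t ∈ Ico 0 D.T, ∀ x,
          Uinf t x = D.g t • gradient (fun z ↦ Real.log (D.gaussianDensity t z D.T xT)) x) ∧
        (∀ t ∈ Ico 0 D.T,
          (D.controlledSDE Uinf).drift t = (D.sde.doob D.T D.gaussianDensity xT).drift t ∧
          (D.controlledSDE Uinf).diffusion t =
            (D.sde.doob D.T D.gaussianDensity xT).diffusion t) ∧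
        ∀ ν : Measure (EuclideanSpace ℝ (Fin d)), IsProbabilityMeasure ν →
          (∀ t ∈ Ioo 0 D.T, ∀ x, 0 < bridgeDensity D.T D.gaussianDensity ν xT t x ∧
            DifferentiableAt ℝ (bridgeDensity D.T D.gaussianDensity ν xT t) x) ∧
          ∀ (Ω : Type) (mΩ : MeasurableSpace Ω) (ℱ : Filtration ℝ mΩ) (P : Measure Ω)
            (X : ℝ → Ω → EuclideanSpace ℝ (Fin d)),
            IsWeakSolution (D.controlledSDE Uinf) (Ico 0 D.T) ℱ P X → P.map (X 0) = ν →
            IsMarginalDensity P X (Ioo 0 D.T) (bridgeDensity D.T D.gaussianDensity ν xT) ∧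
            ∀ q, IsMarginalDensity P X (Ioo 0 D.T) q → ∀ t ∈ Ioo 0 D.T,
              ((D.controlledSDE Uinf).reverse q).drift t =
                ((D.sde.doob D.T D.gaussianDensity xT).reverse
                  (bridgeDensity D.T D.gaussianDensity ν xT)).drift t ∧
              ((D.controlledSDE Uinf).reverse q).diffusion t =
                ((D.sde.doob D.T D.gaussianDensity xT).reverse
                  (bridgeDensity D.T D.gaussianDensity ν xT)).diffusion t) ∧
    -- the optimal controls of the problem with a fixed initial state `x₀`, as functions of time
    (∀ (x₀ : EuclideanSpace ℝ (Fin d)) (u X : ℝ → ℝ → EuclideanSpace ℝ (Fin d)),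
      (∀ γ : ℝ, 0 < γ → IsOptimalPair D xT γ 0 x₀ (u γ) (X γ)) →
      ∃ Xinf : ℝ → EuclideanSpace ℝ (Fin d),
        (∀ t ∈ Icc 0 D.T, Tendsto (fun γ ↦ X γ t) atTop (𝓝 (Xinf t))) ∧
        Tendsto (fun γ ↦ eLpNorm (fun t ↦ u γ t - D.g t •
            gradient (fun z ↦ Real.log (D.gaussianDensity t z D.T xT)) (Xinf t))
          2 (volume.restrict (Icc 0 D.T))) atTop (𝓝 0) ∧
        IsAdmissiblePair D 0 x₀ (fun t ↦ D.g t •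
            gradient (fun z ↦ Real.log (D.gaussianDensity t z D.T xT)) (Xinf t)) Xinf ∧
        Xinf D.T = xT) := by
  have hD : D.IsRegular := ⟨hT, hf, hh, hg, hg0⟩
  refine ⟨hD.isTransitionDensity, fun γ hγ ↦ ⟨D.optimalFeedback xT γ,
    hD.isOptimalFeedback_optimalFeedback xT hγ, fun V hV t ht x ↦ hD.eq_optimalFeedback hγ hV ht x⟩,
    fun U hU ↦ ?_, fun x₀ u X h ↦ hD.tendsto_isOptimalPair xT x₀ h⟩
  set Uinf : ℝ → EuclideanSpace ℝ (Fin d) → EuclideanSpace ℝ (Fin d) := fun t x ↦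
    D.g t • gradient (fun z ↦ Real.log (D.gaussianDensity t z D.T xT)) x with hUinf
  have hdrift : ∀ t, (D.controlledSDE Uinf).drift t =
      (D.sde.doob D.T D.gaussianDensity xT).drift t := fun t ↦ by
    ext1 x
    simp only [LinearData.controlledSDE, SDE.doob, doobH, LinearData.sde, hUinf, smul_smul, sq]
  refine ⟨Uinf, fun t ht x ↦ ?_, fun t _ x ↦ rfl, fun t _ ↦ ⟨hdrift t, rfl⟩, fun ν hν ↦ ?_⟩
  · refine (hD.tendsto_optimalFeedback xT ht x).congr' ?_
    filter_upwards [eventually_gt_atTop 0] with γ hγ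
    exact (hD.eq_optimalFeedback hγ (hU γ hγ) (Ico_subset_Icc_self ht) x).symm
  have hbridge : ∀ t ∈ Ioo 0 D.T, bridgeDensity D.T D.gaussianDensity ν xT t =
      fun x ↦ ∫ x₀, isoGaussianPDF (D.bridgeVar t) (D.bridgeMean xT t x₀) x ∂ν := fun t ht ↦ by
    ext x; exact hD.bridgeDensity_eq ht ν xT x
  have hpos : ∀ t ∈ Ioo 0 D.T, ∀ x, 0 < bridgeDensity D.T D.gaussianDensity ν xT t x :=
    fun t ht x ↦ by
      rw [hbridge t ht]
      exact integral_isoGaussianPDF_pos (hD.bridgeVar_pos ht)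
        (LinearData.continuous_bridgeMean xT t) ν x
  have hdiff : ∀ t ∈ Ioo 0 D.T, Differentiable ℝ (bridgeDensity D.T D.gaussianDensity ν xT t) :=
    fun t ht ↦ by
      rw [hbridge t ht]
      exact differentiable_integral_isoGaussianPDF (hD.bridgeVar_pos ht)
        (LinearData.continuous_bridgeMean xT t) ν
  refine ⟨fun t ht x ↦ ⟨hpos t ht x, hdiff t ht x⟩, fun Ω mΩ ℱ P X hX hX0 ↦ ?_⟩
  have hmarg : IsMarginalDensity P X (Ioo 0 D.T) (bridgeDensity D.T D.gaussianDensity ν xT) :=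
    fun t ht ↦ ⟨(hdiff t ht).continuous, fun x ↦ (hpos t ht x).le, by
      rw [← hX0]; exact hD.bridge_law xT (fun r _ ↦ hdrift r) rfl hX ht⟩
  refine ⟨hmarg, fun q hq t ht ↦ ⟨?_, rfl⟩⟩
  ext1 x
  simp only [SDE.reverse, hdrift t, hq.eq_of_eq hmarg ht]
  rfl
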